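/- **Notation.** For $z=(x,\omega)\in\mathbb R^2$ and $f\in L^2(\mathbb R)$ let $\pi(z)f(t)=e^{2\pi i\omega t}f(t-x)$ and, for $\phi\in L^2(\mathbb R)$, let $V_\phi f(z)=\langle f,\pi(z)\phi\rangle$. For $m\in L^1(\mathbb R^2)$ let $H_{m,\phi}f=\int_{\mathbb R^2}m(z)\,V_\phi f(z)\,\pi(z)\phi\,dz$ be the localization operator with symbol $m$ and window $\phi$. Let $\varphi_0(t)=2^{1/4}e^{-\pi t^2}$. **Windows.** Let $(\phi_i)_{i\in I}$ be a family in $L^2(\mathbb R)$ satisfying one of the following two conditions. (a) $I=\{1,2\}$, $\|\phi_1\|_2=\|\phi_2\|_2=1$ and $\|\phi_1-\phi_2\|_2<\tfrac12$. (b) There are constants $C$ and $s>1$ such that $\big(|V_{\varphi_0}\phi_i|*|V_{\varphi_0}\phi_i|\big)(z)\le C(1+|z|^2)^{-s}$ for all $i\in I$ and $z\in\mathbb R^2$, and there is a constant $C_0$ with $2C_0<\|V_{\varphi_0}\varphi_0\|_{L^1(\mathbb R^2)}$ such that $|V_{\varphi_0}\varphi_0(z)-V_{\varphi_0}\phi_i(z)|<C_0\,|V_{\varphi_0}\varphi_0(z)|$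 for all $i\in I$ and $z\in\mathbb R^2$. **Symbols.** Let $\Gamma\subset\mathbb R^2$ be relatively separated, i.e. the number of points of $\Gamma$ in a ball of radius $1$ is bounded uniformly in the centre of the ball. Let $\eta_\gamma\colon\mathbb R^2\to[0,\infty)$, $\gamma\in\Gamma$, be integrable functions such that $\eta_\gamma(\xi)\le g(\xi-\gamma)$ for all $\xi\in\mathbb R^2$, $\gamma\in\Gamma$, where $g\in L^2(\mathbb R^2)$ is continuous and $|g(z)|\le C'(1+|z|^2)^{-s'}$ for some constants $C'$ and $s'>1$. Suppose that there are constants $0<A\le B<\infty$ with $A\le\sum_{\gamma\in\Gamma}\eta_\gamma(z)\le B$ for all $z\in\mathbb R^2$. **Theorem.** There is an $\varepsilon>0$ such that the following holds. For $i\in I$ and $\gamma\in\Gamma$ let $E_{i,\gamma}$ be any full orthonormal collection of eigenfunctions of $H_{\eta_\gamma,\phi_i}$ for eigenvalues bigger than $\varepsilon$, i.e. $E_{i,\gamma}$ is an orthonormal set of such eigenfunctions and every eigenfunction for an eigenvalue bigger than $\varepsilon$ lies in its closed linear span. Then: 1. for each fixed $i\in I$, the system $\{e : \gamma\in\Gamma,\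 e\in E_{i,\gamma}\}$ is a frame for $L^2(\mathbb R)$, that is, there are $0<A_i\le B_i<\infty$ with $A_i\|f\|_2^2\le\sum_{\gamma\in\Gamma}\sum_{e\in E_{i,\gamma}}|\langle f,e\rangle|^2\le B_i\|f\|_2^2$ for all $f\in L^2(\mathbb R)$; 2. these frames are woven: for every partition $(\sigma_i)_{i\in I}$ of $\Gamma$ (empty parts allowed), the system $\{e : i\in I,\ \gamma\in\sigma_i,\ e\in E_{i,\gamma}\}$ is a frame for $L^2(\mathbb R)$. -/

import Mathlib

open MeasureTheory
open scoped ENNReal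

noncomputable section

/-- The Hilbert space `L²(ℝ)` of complex-valued functions. -/
abbrev L2 : Type := Lp ℂ 2 (volume : Measure ℝ)

/-- Phase space `ℝ × ℝ`; a point is `z = (x, ω)`. Its measure is Lebesgue measure. -/
abbrev Phase : Type := ℝ × ℝ

theorem memLp_tfShift (z : Phase) (f : L2) :
    MemLp (fun t : ℝ => Complex.exp (2 * Real.pi * Complex.I * z.2 * t) * f (t - z.1)) 2
      (volume : Measure ℝ) := by
  have h1 : MemLp (fun t : ℝ => f (t - z.1)) 2 (volume : Measure ℝ) :=
    (Lp.memLp f).comp_measurePreserving (measurePreserving_sub_right volume z.1)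
  have hc : Continuous (fun t : ℝ => Complex.exp (2 * Real.pi * Complex.I * z.2 * t)) := by
    fun_prop
  refine h1.of_le (hc.aestronglyMeasurable.mul h1.aestronglyMeasurable)
    (Filter.Eventually.of_forall fun t => ?_)
  have : (2 * Real.pi * Complex.I * z.2 * t : ℂ)
      = ((2 * Real.pi * z.2 * t : ℝ) : ℂ) * Complex.I := by push_cast; ring
  rw [norm_mul, this, Complex.norm_exp_ofReal_mul_I, one_mul]

/-- The time-frequency shift `π(x, ω) f (t) = e^{2 π i ω t} f (t - x)` on `L²(ℝ)`. -/
def tfShift (z : Phase) (f : L2) : L2 := (memLp_tfShift z f).toLp _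

/-- The short-time Fourier transform `V_φ f (z) = ⟨f, π(z) φ⟩`, where `⟨·,·⟩` is linear in its
first slot (Mathlib's `inner` is linear in the second one). -/
def stft (φ f : L2) (z : Phase) : ℂ := inner ℂ (tfShift z φ) f

/-- The localization operator `H_{m,φ} f = ∫ m(z) V_φ f (z) π(z) φ dz` for a symbol
`m ∈ L¹(ℝ²)`, as an `L²(ℝ)`-valued (Bochner) integral; it converges absolutely. -/
def locOp (m : Phase → ℝ) (φ f : L2) : L2 :=
  ∫ z : Phase, ((m z : ℂ) * stft φ f z) • tfShift z φ

theorem memLp_gauss :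
    MemLp (fun t : ℝ => (((2 : ℝ) ^ (1 / 4 : ℝ) * Real.exp (-Real.pi * t ^ 2) : ℝ) : ℂ)) 2
      (volume : Measure ℝ) := by
  have hc : Continuous (fun t : ℝ => (2 : ℝ) ^ (1 / 4 : ℝ) * Real.exp (-Real.pi * t ^ 2)) := by
    fun_prop
  refine MemLp.ofReal ((memLp_two_iff_integrable_sq hc.aestronglyMeasurable).2 ?_)
  have h := (integrable_exp_neg_mul_sq (b := 2 * Real.pi) (by positivity)).const_mul
    (((2 : ℝ) ^ (1 / 4 : ℝ)) ^ 2)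
  refine h.congr (Filter.Eventually.of_forall fun t => ?_)
  simp only [mul_pow, ← Real.exp_nat_mul]
  congr 2
  push_cast
  ring

/-- The normalized Gaussian `φ₀(t) = 2^{1/4} e^{-π t²}`. -/
def gauss : L2 := memLp_gauss.toLp _

/-- The convolution `(F ∗ G)(z) = ∫ F(w) G(z - w) dw` on phase space. -/
def conv (F G : Phase → ℝ) (z : Phase) : ℝ := ∫ w : Phase, F w * G (z - w)

/-- `F(z) ≤ C (1 + |z|²)^{-s}` for all `z`, where `|z|` is the Euclidean norm. -/
def DecaysWith (C s : ℝ) (F : Phase → ℝ) : Prop :=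
  ∀ z : Phase, F z ≤ C * (1 + (z.1 ^ 2 + z.2 ^ 2)) ^ (-s)

/-- A set of points in phase space is relatively separated if the number of its points in a
ball of radius one is bounded uniformly in the centre of the ball. -/
def RelativelySeparated (Γ : Set Phase) : Prop :=
  ∃ N : ℕ, ∀ z : Phase, (Γ ∩ Metric.closedBall z 1).encard ≤ N

/-- A well-spread family of symbols: integrable functions `η_γ` indexed by a relatively
separated set `Γ`, with `|η_γ(ξ)| ≤ g(ξ - γ)` for one continuous envelope `g ∈ L²(ℝ²)` of
(integrable) polynomial decay `|g(z)| ≤ C (1 + |z|²)^{-s}`, `s > 1`. -/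
structure WellSpread (Γ : Set Phase) (η : Γ → Phase → ℝ) : Prop where
  separated : RelativelySeparated Γ
  integrable : ∀ γ : Γ, Integrable (η γ)
  envelope : ∃ g : Phase → ℝ, Continuous g ∧ MemLp g 2 ∧
    (∃ C s : ℝ, 1 < s ∧ DecaysWith C s fun z => |g z|) ∧
    ∀ (γ : Γ) (ξ : Phase), |η γ ξ| ≤ g (ξ - γ)

/-- `∑_γ η_γ(z) ≈ 1`: there are constants `0 < A ≤ B` with `A ≤ ∑_γ η_γ(z) ≤ B` for all `z`. -/
def SumApproxOne {Γ : Set Phase} (η : Γ → Phase → ℝ) : Prop :=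
  ∃ A B : ℝ, 0 < A ∧ A ≤ B ∧ ∀ z : Phase,
    Summable (fun γ : Γ => η γ z) ∧ A ≤ ∑' γ : Γ, η γ z ∧ ∑' γ : Γ, η γ z ≤ B

/-- The norm condition on windows: there are two of them, `φ_a` and `φ_b`, of unit norm, and
`‖φ_a - φ_b‖ < 1/2`. -/
def NormClose {I : Type*} (φ : I → L2) : Prop :=
  ∃ a b : I, a ≠ b ∧ (∀ i, i = a ∨ i = b) ∧ ‖φ a‖ = 1 ∧ ‖φ b‖ = 1 ∧ ‖φ a - φ b‖ < 1 / 2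

/-- The phase-space condition on a collection of windows `φ_i`: the decay
`(|V_{φ₀} φ_i| ∗ |V_{φ₀} φ_i|)(z) ≤ C (1 + |z|²)^{-s}` with `s > 1`, and the pointwise bound
`|V_{φ₀} φ₀ (z) - V_{φ₀} φ_i (z)| < C₀ |V_{φ₀} φ₀ (z)|` with `2 C₀ < ‖V_{φ₀} φ₀‖₁`, where the
constants do not depend on `i`. -/
def PhaseSpaceClose {I : Type*} (φ : I → L2) : Prop :=
  (∃ C s : ℝ, 1 < s ∧ ∀ i, DecaysWith C s
    (conv (fun z => ‖stft gauss (φ i) z‖) (fun z => ‖stft gauss (φ i) z‖))) ∧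
  ∃ C₀ : ℝ,
    (∀ (i : I) (z : Phase),
      ‖stft gauss gauss z - stft gauss (φ i) z‖ < C₀ * ‖stft gauss gauss z‖) ∧
    2 * C₀ < ∫ z : Phase, ‖stft gauss gauss z‖

/-- `E` is a full orthonormal collection of eigenfunctions of `T` for eigenvalues bigger than
`ε`: its members are orthonormal, each of them is an eigenfunction of `T` for an eigenvalue
bigger than `ε`, and every eigenfunction for such an eigenvalue lies in the closed span of `E`. -/
structure IsEigenCollection (T : L2 → L2) (ε : ℝ) (E : Set L2) : Prop where
  orthonormal : Orthonormal ℂ (fun e : E => (e : L2))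
  eigen : ∀ e ∈ E, ∃ μ : ℝ, ε < μ ∧ T e = (μ : ℂ) • e
  complete : ∀ (f : L2) (μ : ℝ), ε < μ → T f = (μ : ℂ) • f →
    f ∈ (Submodule.span ℂ E).topologicalClosure

/-- The family `(x_j)` is a frame for `L²(ℝ)`: `A ‖f‖² ≤ ∑_j |⟨f, x_j⟩|² ≤ B ‖f‖²`. -/
def IsFrame {ι : Type*} (x : ι → L2) : Prop :=
  ∃ A B : ℝ, 0 < A ∧ A ≤ B ∧ ∀ f : L2,
    Summable (fun j => ‖inner ℂ (x j) f‖ ^ 2) ∧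
    A * ‖f‖ ^ 2 ≤ ∑' j, ‖inner ℂ (x j) f‖ ^ 2 ∧
    ∑' j, ‖inner ℂ (x j) f‖ ^ 2 ≤ B * ‖f‖ ^ 2

/-- The collections `E_{i,γ}`, labelled by `γ ∈ Γ` and `i ∈ I`, are woven: for every partition
`(σ_i)` of `Γ`, with empty parts allowed, the union over `i` of the collections `E_{i,γ}` with
`γ ∈ σ_i` is a frame. -/
def IsWoven {I : Type*} {Γ : Set Phase} (E : I → Γ → Set L2) : Prop :=
  ∀ σ : I → Set Γ, Pairwise (fun i j => Disjoint (σ i) (σ j)) → ⋃ i, σ i = Set.univ →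
    IsFrame (fun p : (Σ i : I, Σ γ : σ i, E i γ) => (p.2.2 : L2))

end

/-!
The theorem reduces to two estimates for the positive compact operators `H_γ`, where `H_γ` is the
localization operator with symbol `η_γ` and a window selected, for each `γ`, among the `φ_i`:
`∑_γ ⟨f, H_γ f⟩ ≤ K ‖f‖²` and `c ‖f‖² ≤ ∑_γ ‖H_γ f‖²`, with constants that do not depend on the
selection (`exists_bounds_locOp`). Indeed, `ε ∑_e |⟨e, f⟩|² ≤ ⟨f, H_γ f⟩` and
`‖H_γ f‖² ≤ K² ∑_e |⟨e, f⟩|² + ε ⟨f, H_γ f⟩` when `e` runs through the eigenfunctions for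
eigenvalues above `ε` (`IsEigenCollection.bounds`), and with `ε = c / (2K)` the sum over `γ` gives
both frame bounds. A single frame is the case of a constant selection, and a partition of `Γ` is a
selection.

The upper estimate is Moyal's identity `‖V_φ f‖₂ = ‖φ‖₂ ‖f‖₂`. For the lower one
(`exists_le_tsum_norm_locOp_sq`), suppose first that the windows `θ_j` form a finite family with
`∑_j ‖θ_j - θ₀‖² < 1/2` for a unit window `θ₀`. By `|V_{θ₀} f|² ≤ 2 |V_{θ_j} f|² +
2 |V_{θ_j - θ₀} f|²`, the forms `⟨f, H_γ f⟩ = ∫ η_γ |V_{θ_j} f|²` sum to at least a multiple of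
`‖f‖²` (`le_tsum_integral_mul_stft`). To pass from the forms to the norms, choose the Gaussian
cut-off `ω_γ(z) = e^{-πδ²|z-γ|²}` and let `g_γ` be `f` localized by `ω_γ` with the window `θ₀`. For
small `δ`, replacing `V_{θ_j} f` by `V_{θ_j} g_γ` in `⟨f, H_γ f⟩` costs little, summed over `γ`,
and `⟨g_γ, H_γ f⟩` is bounded by `‖g_γ‖ ‖H_γ f‖`, while `∑_γ ‖g_γ‖² ≤ M ‖f‖²`. The cost has two
parts. The mass of `η_γ` where `ω_γ` is not close to `1` is small because `Γ` is relatively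
separated and `η_γ` decays (`WellSpread.eventually_tail_le`). The difference
`ω_γ V_{θ_j} f - V_{θ_j} g_γ` is small because `ω_γ` is a Gaussian average of symplectic characters,
and multiplying `V_φ f` by the character of `v` replaces `φ` and `f` by `π(v) φ` and `π(v) f`. So
the difference is an average of `V_χ (π(δv) f)` with windows `χ = π(δv) θ_j - κ θ_j`, `κ` a scalar
close to `1`, which tend to zero with `δ` (`tsum_defect_le`, `tendsto_meanShiftDefect`).

The norm condition on the windows is covered by `θ₀ = φ_a`. Under the phase-space condition, the
quotient `V_{φ₀} φ_i / V_{φ₀} φ₀` is, up to conjugation of the variable, a bounded entire function.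
By Liouville's theorem the windows are multiples `c_i φ₀` of the Gaussian, and
`2 C₀ < ‖V_{φ₀} φ₀‖₁ = 2` gives `|1 - c_i| < C₀ < 1`
(`PhaseSpaceClose.exists_eq_smul_gauss`). This reduces to the single window `φ₀`.
-/

noncomputable section

/-! ### Time-frequency shifts and the short-time Fourier transform -/

theorem coeFn_tfShift (z : Phase) (f : L2) :
    tfShift z f =ᵐ[volume]
      fun t : ℝ => Complex.exp (2 * Real.pi * Complex.I * z.2 * t) * f (t - z.1) :=
  MemLp.coeFn_toLp _

theorem norm_exp_two_pi_mul (a b : ℝ) :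
    ‖Complex.exp (2 * Real.pi * Complex.I * a * b)‖ = 1 := by
  have : (2 * Real.pi * Complex.I * a * b : ℂ) = ((2 * Real.pi * a * b : ℝ) : ℂ) * Complex.I := by
    push_cast; ring
  rw [this, Complex.norm_exp_ofReal_mul_I]

theorem ae_comp_sub {p : ℝ → Prop} (x : ℝ) (h : ∀ᵐ t : ℝ, p t) : ∀ᵐ t : ℝ, p (t - x) :=
  (measurePreserving_sub_right (volume : Measure ℝ) x).quasiMeasurePreserving.ae h

theorem norm_tfShift (z : Phase) (f : L2) : ‖tfShift z f‖ = ‖f‖ := by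
  rw [Lp.norm_def, Lp.norm_def]
  congr 1
  rw [eLpNorm_congr_ae (coeFn_tfShift z f)]
  rw [eLpNorm_congr_norm_ae (g := (f : ℝ → ℂ) ∘ fun t => t - z.1)]
  · exact eLpNorm_comp_measurePreserving (Lp.aestronglyMeasurable f)
      (measurePreserving_sub_right volume z.1)
  · filter_upwards with t
    rw [norm_mul, norm_exp_two_pi_mul, one_mul, Function.comp]

theorem tfShift_add (z : Phase) (f g : L2) : tfShift z (f + g) = tfShift z f + tfShift z g := by
  apply Lp.ext
  filter_upwards [coeFn_tfShift z (f + g), coeFn_tfShift z f, coeFn_tfShift z g,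
    Lp.coeFn_add (tfShift z f) (tfShift z g), ae_comp_sub z.1 (Lp.coeFn_add f g)]
    with t h1 h2 h3 h4 h5
  rw [h1, h4, Pi.add_apply, h2, h3, h5, Pi.add_apply, mul_add]

theorem tfShift_smul (z : Phase) (c : ℂ) (f : L2) : tfShift z (c • f) = c • tfShift z f := by
  apply Lp.ext
  filter_upwards [coeFn_tfShift z (c • f), coeFn_tfShift z f,
    Lp.coeFn_smul c (tfShift z f), ae_comp_sub z.1 (Lp.coeFn_smul c f)]
    with t h1 h2 h3 h4
  rw [h1, h3, Pi.smul_apply, h2, h4, Pi.smul_apply, smul_eq_mul, smul_eq_mul]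
  ring

/-- The time-frequency shift `π(z)` as a linear isometry of `L²(ℝ)`. -/
def tfShiftₗᵢ (z : Phase) : L2 →ₗᵢ[ℂ] L2 where
  toFun := tfShift z
  map_add' := tfShift_add z
  map_smul' := tfShift_smul z
  norm_map' := norm_tfShift z

theorem tfShift_sub (z : Phase) (f g : L2) : tfShift z (f - g) = tfShift z f - tfShift z g :=
  map_sub (tfShiftₗᵢ z) f g

theorem inner_tfShift_tfShift (z : Phase) (f g : L2) :
    inner ℂ (tfShift z f) (tfShift z g) = inner ℂ f g :=
  (tfShiftₗᵢ z).inner_map_map f g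

theorem tfShift_zero (f : L2) : tfShift 0 f = f := by
  apply Lp.ext
  filter_upwards [coeFn_tfShift 0 f] with t h1
  rw [h1]
  simp

theorem tfShift_modulation_translation (x ω : ℝ) (f : L2) :
    tfShift (x, ω) f = tfShift (0, ω) (tfShift (x, 0) f) := by
  apply Lp.ext
  filter_upwards [coeFn_tfShift (x, ω) f, coeFn_tfShift (0, ω) (tfShift (x, 0) f),
    coeFn_tfShift (x, 0) f] with t h1 h2 h3
  rw [h1, h2]
  simp only [sub_zero]
  rw [h3]
  simp

/-- The symplectic character `z ↦ e^{2πi(ξx - yω)}` of phase space attached to `v = (y, ξ)`,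
where `z = (x, ω)`. -/
def sympChar (v z : Phase) : ℂ :=
  Complex.exp ((2 * Real.pi * (v.2 * z.1 - v.1 * z.2) : ℝ) * Complex.I)

theorem norm_sympChar (v z : Phase) : ‖sympChar v z‖ = 1 :=
  Complex.norm_exp_ofReal_mul_I _

theorem sympChar_sub (v z w : Phase) :
    sympChar v (z - w) = sympChar v z * sympChar v (-w) := by
  simp only [sympChar, ← Complex.exp_add]
  congr 1
  simp only [Prod.fst_sub, Prod.snd_sub, Prod.fst_neg, Prod.snd_neg]
  push_cast
  ring

@[fun_prop]
theorem continuous_sympChar : Continuous fun p : Phase × Phase => sympChar p.1 p.2 := by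
  unfold sympChar
  fun_prop

/-- The commutation relation of time-frequency shifts. -/
theorem tfShift_comm (z v : Phase) (f : L2) :
    tfShift v (tfShift z f) = sympChar v z • tfShift z (tfShift v f) := by
  apply Lp.ext
  filter_upwards [coeFn_tfShift v (tfShift z f), coeFn_tfShift z (tfShift v f),
    Lp.coeFn_smul (sympChar v z) (tfShift z (tfShift v f)),
    ae_comp_sub v.1 (coeFn_tfShift z f), ae_comp_sub z.1 (coeFn_tfShift v f)] with t h1 h2 h3 h4 h5
  rw [h1, h3, Pi.smul_apply, h2, h4, h5, smul_eq_mul, sympChar, ← mul_assoc, ← mul_assoc,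
    ← mul_assoc, ← Complex.exp_add, ← Complex.exp_add, ← Complex.exp_add]
  congr 1
  · congr 1
    push_cast
    ring
  · congr 1
    ring

theorem continuous_translation (f : L2) : Continuous fun x : ℝ => tfShift (x, 0) f := by
  have hmp : ∀ x : ℝ, MeasurePreserving (fun t : ℝ => t - x) volume volume :=
    fun x => measurePreserving_sub_right volume x
  let G : C(ℝ, C(ℝ, ℝ)) :=
    ContinuousMap.curry ⟨fun p : ℝ × ℝ => p.2 - p.1, by fun_prop⟩
  have h := Continuous.compMeasurePreservingLp (p := 2) (μ := volume) (ν := volume)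
    (f := fun _ : ℝ => f) (g := G) continuous_const G.continuous hmp (by simp)
  refine h.congr fun x => ?_
  apply Lp.ext
  filter_upwards [coeFn_tfShift (x, 0) f, Lp.coeFn_compMeasurePreserving f (hmp x)] with t h1 h2
  rw [h1]
  refine h2.trans ?_
  simp

theorem continuous_modulation (f : L2) : Continuous fun ω : ℝ => tfShift (0, ω) f := by
  rw [continuous_iff_continuousAt]
  intro ω₀
  rw [ContinuousAt, Lp.tendsto_Lp_iff_tendsto_eLpNorm']
  have key : Filter.Tendsto (fun ω : ℝ => ∫⁻ t : ℝ,
      ‖(Complex.exp (2 * Real.pi * Complex.I * ω * t) -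
        Complex.exp (2 * Real.pi * Complex.I * ω₀ * t)) * f t‖ₑ ^ 2)
      (nhds ω₀) (nhds (∫⁻ t : ℝ, 0)) := by
    refine tendsto_lintegral_filter_of_dominated_convergence' (fun t => (2 * ‖f t‖ₑ) ^ 2)
      ?_ ?_ ?_ ?_
    · refine Filter.Eventually.of_forall fun ω => ?_
      have hc : Continuous fun t : ℝ => Complex.exp (2 * Real.pi * Complex.I * ω * t) -
        Complex.exp (2 * Real.pi * Complex.I * ω₀ * t) := by fun_prop
      exact ((hc.aestronglyMeasurable.mul (Lp.aestronglyMeasurable f)).enorm).pow_const 2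
    · refine Filter.Eventually.of_forall fun ω => Filter.Eventually.of_forall fun t => ?_
      rw [enorm_mul]
      gcongr
      refine (enorm_sub_le).trans ?_
      rw [← ofReal_norm, ← ofReal_norm, norm_exp_two_pi_mul, norm_exp_two_pi_mul]
      norm_num
    · have h2 := (Lp.memLp f).eLpNorm_lt_top
      rw [eLpNorm_lt_top_iff_lintegral_rpow_enorm_lt_top (by simp) (by simp)] at h2
      simp only [mul_pow]
      rw [lintegral_const_mul' _ _ (by simp)]
      simp only [ENNReal.toReal_ofNat, ENNReal.rpow_ofNat] at h2
      exact (ENNReal.mul_lt_top (by simp) h2).ne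
    · refine Filter.Eventually.of_forall fun t => ?_
      have hc : Continuous fun ω : ℝ => ‖(Complex.exp (2 * Real.pi * Complex.I * ω * t) -
        Complex.exp (2 * Real.pi * Complex.I * ω₀ * t)) * f t‖ₑ ^ 2 := by
        refine ENNReal.continuous_pow 2 |>.comp ?_
        refine continuous_enorm.comp ?_
        fun_prop
      have := hc.tendsto ω₀
      simpa using this
  have h3 := (ENNReal.continuous_rpow_const (y := 1 / 2)).tendsto _ |>.comp key
  simp only [lintegral_zero] at h3
  rw [ENNReal.zero_rpow_of_pos (by norm_num)] at h3
  refine h3.congr fun ω => ?_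
  rw [eLpNorm_eq_lintegral_rpow_enorm_toReal (by simp) (by simp)]
  simp only [ENNReal.toReal_ofNat, ENNReal.rpow_ofNat, Function.comp]
  congr 1
  apply lintegral_congr_ae
  filter_upwards [coeFn_tfShift (0, ω) f, coeFn_tfShift (0, ω₀) f] with t h1 h2
  rw [Pi.sub_apply, h1, h2, sub_mul]
  simp

-- unfolding to functions on the real line makes unification in `L²(ℝ)` very slow
attribute [local irreducible] tfShift

/-- Strong continuity of the Schrödinger representation, jointly in both variables. -/
theorem continuous_tfShift : Continuous fun p : Phase × L2 => tfShift p.1 p.2 := by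
  have h1 : Continuous fun p : ℝ × L2 => tfShift (0, p.1) p.2 :=
    continuous_prod_of_continuous_lipschitzWith' _ 1
      (fun ω => (tfShiftₗᵢ (0, ω)).lipschitz) continuous_modulation
  have h2 : Continuous fun p : ℝ × L2 => tfShift (p.1, 0) p.2 :=
    continuous_prod_of_continuous_lipschitzWith' _ 1
      (fun x => (tfShiftₗᵢ (x, 0)).lipschitz) continuous_translation
  have h4 : Continuous fun p : Phase × L2 => (p.1.1, p.2) :=
    (continuous_fst.comp continuous_fst).prodMk continuous_snd
  have h5 : Continuous fun p : Phase × L2 => tfShift (p.1.1, 0) p.2 :=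
    h2.comp h4
  have h6 : Continuous fun p : Phase × L2 => (p.1.2, tfShift (p.1.1, 0) p.2) :=
    (continuous_snd.comp continuous_fst).prodMk h5
  have h3 : Continuous fun p : Phase × L2 => tfShift (0, p.1.2) (tfShift (p.1.1, 0) p.2) :=
    h1.comp h6
  simpa only [← tfShift_modulation_translation] using h3

theorem continuous_tfShift_comp {X : Type*} [TopologicalSpace X] {z : X → Phase} {f : X → L2}
    (hz : Continuous z) (hf : Continuous f) : Continuous fun x => tfShift (z x) (f x) := by
  have h : Continuous fun x => (z x, f x) := hz.prodMk hf
  exact continuous_tfShift.comp h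

theorem continuous_stft_comp {X : Type*} [TopologicalSpace X] {φ f : X → L2} {z : X → Phase}
    (hφ : Continuous φ) (hf : Continuous f) (hz : Continuous z) :
    Continuous fun x => stft (φ x) (f x) (z x) :=
  Continuous.inner (𝕜 := ℂ) (continuous_tfShift_comp hz hφ) hf

theorem continuous_stft (φ f : L2) : Continuous (stft φ f) :=
  continuous_stft_comp continuous_const continuous_const continuous_id

theorem norm_stft_le (φ f : L2) (z : Phase) : ‖stft φ f z‖ ≤ ‖φ‖ * ‖f‖ := by
  simpa [stft, norm_tfShift] using norm_inner_le_norm (𝕜 := ℂ) (tfShift z φ) f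

theorem stft_add_right (φ f g : L2) (z : Phase) :
    stft φ (f + g) z = stft φ f z + stft φ g z := inner_add_right _ _ _

theorem stft_smul_right (φ f : L2) (c : ℂ) (z : Phase) :
    stft φ (c • f) z = c * stft φ f z := inner_smul_right _ _ _

theorem stft_smul_left (φ f : L2) (c : ℂ) (z : Phase) :
    stft (c • φ) f z = starRingEnd ℂ c * stft φ f z := by
  rw [stft, tfShift_smul, inner_smul_left, stft]

theorem stft_add_left (φ ψ f : L2) (z : Phase) :
    stft (φ + ψ) f z = stft φ f z + stft ψ f z := by
  rw [stft, tfShift_add, inner_add_left, stft, stft]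

theorem stft_sub_left (φ ψ f : L2) (z : Phase) :
    stft (φ - ψ) f z = stft φ f z - stft ψ f z := by
  rw [stft, tfShift_sub, inner_sub_left, stft, stft]

/-- Multiplying a short-time Fourier transform by a symplectic character amounts to a
time-frequency shift of both the window and the function. -/
theorem stft_tfShift_tfShift (v : Phase) (φ f : L2) (z : Phase) :
    stft (tfShift v φ) (tfShift v f) z = sympChar v z * stft φ f z := by
  have h : tfShift z (tfShift v φ) = (sympChar v z)⁻¹ • tfShift v (tfShift z φ) := by
    rw [tfShift_comm z v, inv_smul_smul₀]
    exact Complex.exp_ne_zero _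
  have h2 : starRingEnd ℂ (sympChar v z)⁻¹ = sympChar v z := by
    rw [map_inv₀, ← Complex.inv_eq_conj (norm_sympChar v z), inv_inv]
  rw [stft, h, inner_smul_left, inner_tfShift_tfShift, h2, stft]

/-! ### Plancherel's theorem and Moyal's identity -/

open FourierTransform in
/-- On `L¹ ∩ L²` the Fourier transform of `L²` is given by the Fourier integral: both define the
same tempered distribution. -/
theorem fourier_toLp_ae_eq {g : ℝ → ℂ} (h1 : Integrable g) (h2 : MemLp g 2) :
    (𝓕 (h2.toLp g : L2) : L2) =ᵐ[volume] 𝓕 g := by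
  have hc : Continuous (𝓕 g) :=
    VectorFourier.fourierIntegral_continuous Real.continuous_fourierChar
      (by exact continuous_inner) h1
  refine ae_eq_of_integral_contDiff_smul_eq
    ((Lp.memLp _).locallyIntegrable (by norm_num)) hc.locallyIntegrable fun ψ hψ hψc => ?_
  have hψ' : ContDiff ℝ ((⊤ : ℕ∞) : WithTop ℕ∞) fun x => (ψ x : ℂ) :=
    Complex.ofRealCLM.contDiff.comp hψ
  have hψc' : HasCompactSupport fun x => (ψ x : ℂ) := hψc.comp_left (g := fun r : ℝ => (r : ℂ)) rfl
  let Ψ := hψc'.toSchwartzMap hψ'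
  have e1 := congrArg (fun T => T Ψ) (Lp.fourier_toTemperedDistribution_eq (h2.toLp g : L2))
  simp only [TemperedDistribution.fourier_apply, Lp.toTemperedDistribution_apply] at e1
  have e2 : ∫ x, (𝓕 Ψ) x • (h2.toLp g : L2) x = ∫ x, (𝓕 (Ψ : ℝ → ℂ)) x • g x := by
    refine integral_congr_ae ?_
    filter_upwards [h2.coeFn_toLp] with x hx
    rw [hx, SchwartzMap.fourier_coe]
  have e3 : ∫ x, (𝓕 (Ψ : ℝ → ℂ)) x • g x = ∫ x, Ψ x • 𝓕 g x := by
    have := VectorFourier.integral_fourierIntegral_smul_eq_flip (L := innerₗ ℝ)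
      (μ := (volume : Measure ℝ)) (ν := (volume : Measure ℝ)) (e := Real.fourierChar)
      Real.continuous_fourierChar (by exact continuous_inner) Ψ.integrable h1
    simpa only [flip_innerₗ] using! this
  rw [e2, e3] at e1
  have e4 : ∀ (x : ℝ) (c : ℂ), ψ x • c = Ψ x • c := fun x c => by
    have hΨ : Ψ x = (ψ x : ℂ) := rfl
    rw [hΨ, Complex.real_smul, smul_eq_mul]
  simp only [e4]
  exact e1.symm

theorem enorm_sq_eq_lintegral (f : L2) : ‖f‖ₑ ^ 2 = ∫⁻ t, ‖f t‖ₑ ^ 2 := by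
  rw [Lp.enorm_def, eLpNorm_eq_lintegral_rpow_enorm_toReal (by simp) (by simp)]
  simp only [ENNReal.toReal_ofNat, ENNReal.rpow_ofNat]
  rw [← ENNReal.rpow_natCast, ← ENNReal.rpow_mul]
  norm_num

open FourierTransform in
theorem lintegral_fourier_sq {g : ℝ → ℂ} (h1 : Integrable g) (h2 : MemLp g 2) :
    ∫⁻ ξ, ‖𝓕 g ξ‖ₑ ^ 2 = ∫⁻ t, ‖g t‖ₑ ^ 2 := by
  have a1 : ∫⁻ ξ, ‖𝓕 g ξ‖ₑ ^ 2 = ‖(𝓕 (h2.toLp g : L2) : L2)‖ₑ ^ 2 := by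
    rw [enorm_sq_eq_lintegral]
    refine lintegral_congr_ae ?_
    filter_upwards [fourier_toLp_ae_eq h1 h2] with x hx
    rw [hx]
  have a2 : ∫⁻ t, ‖g t‖ₑ ^ 2 = ‖(h2.toLp g : L2)‖ₑ ^ 2 := by
    rw [enorm_sq_eq_lintegral]
    refine lintegral_congr_ae ?_
    filter_upwards [h2.coeFn_toLp] with x hx
    rw [hx]
  rw [a1, a2, ← ofReal_norm, ← ofReal_norm, Lp.norm_fourier_eq]

theorem stft_eq_integral (φ f : L2) (z : Phase) :
    stft φ f z = ∫ t : ℝ, starRingEnd ℂ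
      (Complex.exp (2 * Real.pi * Complex.I * z.2 * t) * φ (t - z.1)) * f t := by
  rw [stft, L2.inner_def]
  refine integral_congr_ae ?_
  filter_upwards [coeFn_tfShift z φ] with t ht
  rw [ht, RCLike.inner_apply, mul_comm]

open FourierTransform in
/-- For a fixed translation, the short-time Fourier transform is a Fourier transform. -/
theorem stft_eq_fourier (φ f : L2) (x ω : ℝ) :
    stft φ f (x, ω) = 𝓕 (fun t => starRingEnd ℂ (φ (t - x)) * f t) ω := by
  rw [stft_eq_integral, Real.fourier_eq']
  refine integral_congr_ae (Filter.Eventually.of_forall fun t => ?_)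
  simp only [map_mul, ← Complex.exp_conj, smul_eq_mul, ← mul_assoc]
  congr 3
  simp [Complex.conj_ofReal, map_ofNat]
  ring

theorem memLp_comp_sub (φ : L2) (x : ℝ) : MemLp (fun t : ℝ => φ (t - x)) 2 volume :=
  (Lp.memLp φ).comp_measurePreserving (measurePreserving_sub_right volume x)

/-- **Moyal's identity**: `‖V_φ f‖₂ = ‖φ‖₂ ‖f‖₂`. It is Plancherel's theorem in the frequency
variable, followed by an integration over the translations. -/
theorem lintegral_stft_sq (φ f : L2) :
    ∫⁻ z, ‖stft φ f z‖ₑ ^ 2 = ‖φ‖ₑ ^ 2 * ‖f‖ₑ ^ 2 := by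
  have hφ := (Lp.stronglyMeasurable φ).measurable
  have hf := (Lp.stronglyMeasurable f).measurable
  have hmeas : Measurable fun p : ℝ × ℝ => ‖φ (p.2 - p.1)‖ₑ ^ 2 * ‖f p.2‖ₑ ^ 2 :=
    ((hφ.comp (measurable_snd.sub measurable_fst)).enorm.pow_const 2).mul
      ((hf.comp measurable_snd).enorm.pow_const 2)
  have key : ∫⁻ x : ℝ, ∫⁻ t : ℝ, ‖φ (t - x)‖ₑ ^ 2 * ‖f t‖ₑ ^ 2 = ‖φ‖ₑ ^ 2 * ‖f‖ₑ ^ 2 := by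
    rw [lintegral_lintegral_swap hmeas.aemeasurable]
    have : ∀ t : ℝ, ∫⁻ x : ℝ, ‖φ (t - x)‖ₑ ^ 2 * ‖f t‖ₑ ^ 2 = ‖φ‖ₑ ^ 2 * ‖f t‖ₑ ^ 2 := by
      intro t
      rw [lintegral_mul_const' _ _ (by simp), enorm_sq_eq_lintegral φ,
        lintegral_sub_left_eq_self (fun s => ‖φ s‖ₑ ^ 2) t]
    simp only [this]
    rw [lintegral_const_mul' _ _ (by simp), enorm_sq_eq_lintegral f]
  have hfin : ∀ᵐ x : ℝ, ∫⁻ t : ℝ, ‖φ (t - x)‖ₑ ^ 2 * ‖f t‖ₑ ^ 2 < ∞ := by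
    refine ae_lt_top hmeas.lintegral_prod_right' ?_
    rw [key]
    exact ENNReal.mul_ne_top (by simp) (by simp)
  rw [Measure.volume_eq_prod, lintegral_prod _
    ((continuous_stft φ f).measurable.enorm.pow_const 2).aemeasurable, ← key]
  refine lintegral_congr_ae ?_
  filter_upwards [hfin] with x hx
  simp only [stft_eq_fourier]
  have hconj : MemLp (fun t : ℝ => starRingEnd ℂ (φ (t - x))) 2 volume :=
    (memLp_comp_sub φ x).star
  have e : ∀ t, ‖starRingEnd ℂ (φ (t - x)) * f t‖ₑ ^ 2 = ‖φ (t - x)‖ₑ ^ 2 * ‖f t‖ₑ ^ 2 := by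
    intro t
    rw [enorm_mul, mul_pow, ← ofReal_norm, RCLike.norm_conj, ofReal_norm]
  have hint : Integrable fun t : ℝ => starRingEnd ℂ (φ (t - x)) * f t :=
    hconj.integrable_mul (Lp.memLp f)
  rw [lintegral_fourier_sq hint]
  · simp only [e]
  · refine ⟨hconj.1.mul (Lp.aestronglyMeasurable f), ?_⟩
    rw [eLpNorm_lt_top_iff_lintegral_rpow_enorm_lt_top (by simp) (by simp)]
    simp only [ENNReal.toReal_ofNat, ENNReal.rpow_ofNat, e]
    exact hx

theorem memLp_stft (φ f : L2) : MemLp (stft φ f) 2 (volume : Measure Phase) := by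
  refine ⟨(continuous_stft φ f).aestronglyMeasurable, ?_⟩
  rw [eLpNorm_lt_top_iff_lintegral_rpow_enorm_lt_top (by simp) (by simp)]
  simp only [ENNReal.toReal_ofNat, ENNReal.rpow_ofNat, lintegral_stft_sq]
  exact ENNReal.mul_lt_top (by simp) (by simp)

theorem integrable_stft_mul_conj_stft (φ χ f u : L2) :
    Integrable fun z => starRingEnd ℂ (stft χ u z) * stft φ f z :=
  (memLp_stft χ u).star.integrable_mul (memLp_stft φ f)

theorem integrable_norm_stft_sq (φ f : L2) : Integrable fun z => ‖stft φ f z‖ ^ 2 :=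
  (memLp_stft φ f).integrable_norm_pow (by simp)

theorem integral_norm_stft_sq (φ f : L2) :
    ∫ z, ‖stft φ f z‖ ^ 2 = ‖φ‖ ^ 2 * ‖f‖ ^ 2 := by
  rw [integral_eq_lintegral_of_nonneg_ae (Filter.Eventually.of_forall fun z => by positivity)
    (integrable_norm_stft_sq φ f).1]
  have : ∀ z, ENNReal.ofReal (‖stft φ f z‖ ^ 2) = ‖stft φ f z‖ₑ ^ 2 := fun z => by
    rw [ENNReal.ofReal_pow (norm_nonneg _), ofReal_norm]
  simp only [this, lintegral_stft_sq]
  simp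

/-- Polarization: a sesquilinear form on `L²(ℝ)` that is a multiple of the inner product on the
diagonal is that multiple of the inner product. -/
theorem eq_mul_inner_of_diagonal {F : L2 → L2 → ℂ} {c : ℂ}
    (hadd : ∀ x y z, F (x + y) z = F x z + F y z) (hadd' : ∀ x y z, F x (y + z) = F x y + F x z)
    (hI : ∀ x y, F (Complex.I • x) y = -Complex.I * F x y)
    (hI' : ∀ x y, F x (Complex.I • y) = Complex.I * F x y)
    (hdiag : ∀ x, F x x = c * inner ℂ x x) (x y : L2) : F x y = c * inner ℂ x y := by
  have h1 := hdiag (x + y)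
  have h2 := hdiag (x + Complex.I • y)
  simp only [hadd, hadd', hI, hI', hdiag, inner_add_left, inner_add_right, inner_smul_left,
    inner_smul_right, Complex.conj_I] at h1 h2
  linear_combination (1 / 2 : ℂ) * h1 - (Complex.I / 2) * h2 +
    (1 / 2 * (F x y - c * inner ℂ x y) - 1 / 2 * (F y x - c * inner ℂ y x)) * Complex.I_sq

/-- **Moyal's identity** in polarized form: the short-time Fourier transforms satisfy the
orthogonality relations. The diagonal case is polarized in the functions, then in the windows. -/
theorem integral_conj_stft_mul_stft (φ χ u f : L2) :
    ∫ z, starRingEnd ℂ (stft χ u z) * stft φ f z = inner ℂ u f * inner ℂ φ χ := by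
  have same : ∀ ψ g : L2, ∫ z, starRingEnd ℂ (stft ψ g z) * stft ψ g z
      = inner ℂ ψ ψ * inner ℂ g g := by
    intro ψ g
    have e : ∀ z, starRingEnd ℂ (stft ψ g z) * stft ψ g z = ((‖stft ψ g z‖ ^ 2 : ℝ) : ℂ) := by
      intro z
      rw [RCLike.conj_mul]
      simp
    simp only [e]
    rw [integral_complex_ofReal, integral_norm_stft_sq, inner_self_eq_norm_sq_to_K,
      inner_self_eq_norm_sq_to_K]
    simp
  have hint := integrable_stft_mul_conj_stft
  have step : ∀ ψ v g : L2, ∫ z, starRingEnd ℂ (stft ψ v z) * stft ψ g z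
      = inner ℂ ψ ψ * inner ℂ v g := by
    intro ψ
    refine eq_mul_inner_of_diagonal (F := fun v g =>
      ∫ z, starRingEnd ℂ (stft ψ v z) * stft ψ g z) ?_ ?_ ?_ ?_ (same ψ)
    · intro x y w
      simp only [stft_add_right, map_add, add_mul]
      exact integral_add (hint _ _ _ _) (hint _ _ _ _)
    · intro x y w
      simp only [stft_add_right, mul_add]
      exact integral_add (hint _ _ _ _) (hint _ _ _ _)
    · intro x y
      simp only [stft_smul_right, map_mul, Complex.conj_I, mul_assoc]
      exact integral_const_mul _ _
    · intro x y
      simp only [stft_smul_right, mul_left_comm _ Complex.I]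
      exact integral_const_mul _ _
  refine eq_mul_inner_of_diagonal (F := fun φ χ =>
    ∫ z, starRingEnd ℂ (stft χ u z) * stft φ f z) (c := inner ℂ u f) ?_ ?_ ?_ ?_ ?_ φ χ
  · intro x y w
    simp only [stft_add_left, mul_add]
    exact integral_add (hint _ _ _ _) (hint _ _ _ _)
  · intro x y w
    simp only [stft_add_left, map_add, add_mul]
    exact integral_add (hint _ _ _ _) (hint _ _ _ _)
  · intro x y
    simp only [stft_smul_left, Complex.conj_I, mul_left_comm _ (-Complex.I)]
    exact integral_const_mul _ _
  · intro x y
    simp only [stft_smul_left, map_mul, Complex.conj_I, map_neg, neg_neg, mul_assoc]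
    exact integral_const_mul _ _
  · intro x
    rw [step, mul_comm]

/-! ### Localization operators and their eigenvectors -/

theorem integrable_locOp_integrand {m : Phase → ℝ} (hm : Integrable m) (φ f : L2) :
    Integrable fun z : Phase => ((m z : ℂ) * stft φ f z) • tfShift z φ := by
  have hc : Continuous fun z : Phase => stft φ f z • tfShift z φ :=
    (continuous_stft φ f).smul (continuous_tfShift_comp continuous_id continuous_const)
  have h := hm.ofReal (𝕜 := ℂ)
  simp only [mul_smul]
  refine Integrable.mono' (hm.norm.mul_const (‖φ‖ * ‖f‖ * ‖φ‖))
    (h.1.smul hc.aestronglyMeasurable) (Filter.Eventually.of_forall fun z => ?_)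
  rw [norm_smul, norm_smul, norm_tfShift]
  simp only [Complex.norm_real]
  gcongr
  exact norm_stft_le φ f z

theorem inner_locOp {m : Phase → ℝ} (hm : Integrable m) (φ u f : L2) :
    inner ℂ u (locOp m φ f)
      = ∫ z, (m z : ℂ) * (starRingEnd ℂ (stft φ u z) * stft φ f z) := by
  rw [locOp, ← integral_inner (integrable_locOp_integrand hm φ f)]
  refine integral_congr_ae (Filter.Eventually.of_forall fun z => ?_)
  simp only [inner_smul_right, stft, inner_conj_symm]
  ring

/-- The integral of a function with values in a closed subspace lies in that subspace, by the
Hahn–Banach theorem. The subspace need not be separable. -/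
theorem integral_mem_of_isClosed {α E : Type*} [MeasurableSpace α] {μ : Measure α}
    [NormedAddCommGroup E] [NormedSpace ℂ E] [CompleteSpace E] (S : Submodule ℂ E)
    (hS : IsClosed (S : Set E)) {f : α → E} (hf : ∀ x, f x ∈ S) (hfi : Integrable f μ) :
    ∫ x, f x ∂μ ∈ S := by
  by_contra hx
  obtain ⟨l, u, hl, hu⟩ := geometric_hahn_banach_closed_point
    (S.restrictScalars ℝ).convex hS hx
  have hu0 : 0 < u := by simpa using hl 0 S.zero_mem
  -- a functional bounded above on a subspace vanishes there
  have hz : ∀ s ∈ S, l s = 0 := by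
    intro s hs
    by_contra hne
    have := hl ((u / l s) • s) ((S.restrictScalars ℝ).smul_mem _ hs)
    rw [map_smul, smul_eq_mul, div_mul_cancel₀ _ hne] at this
    exact lt_irrefl _ this
  rw [← l.integral_comp_comm hfi] at hu
  simp only [fun x => hz _ (hf x), integral_zero] at hu
  exact lt_asymm hu0 hu

/-- The rank-one operators `f ↦ V_φ f (z) π(z) φ`. -/
def rankOneTfShift (φ : L2) (z : Phase) : L2 →L[ℂ] L2 :=
  (innerSL ℂ (tfShift z φ)).smulRight (tfShift z φ)

theorem isCompactOperator_rankOneTfShift (φ : L2) (z : Phase) :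
    IsCompactOperator (rankOneTfShift φ z) := by
  have h : IsCompactOperator (ContinuousLinearMap.toSpanSingleton ℂ (tfShift z φ)) :=
    IsCompactOperator.clm_comp
      ((isCompactOperator_id_iff_locallyCompactSpace (E := ℂ)).2 inferInstance)
      (ContinuousLinearMap.toSpanSingleton ℂ (tfShift z φ))
  exact h.comp_clm (innerSL ℂ (tfShift z φ))

theorem continuous_rankOneTfShift (φ : L2) : Continuous (rankOneTfShift φ) := by
  have h : Continuous fun z : Phase => tfShift z φ :=
    continuous_tfShift_comp continuous_id continuous_const
  have h2 : Continuous fun z : Phase => innerSL ℂ (tfShift z φ) := (innerSL ℂ).continuous.comp h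
  exact ((ContinuousLinearMap.smulRightL ℂ L2 L2).continuous.comp h2).clm_apply h

theorem norm_rankOneTfShift_le (φ : L2) (z : Phase) : ‖rankOneTfShift φ z‖ ≤ ‖φ‖ * ‖φ‖ := by
  refine ContinuousLinearMap.opNorm_le_bound _ (by positivity) fun f => ?_
  rw [rankOneTfShift, ContinuousLinearMap.smulRight_apply, innerSL_apply_apply, norm_smul]
  have := norm_inner_le_norm (𝕜 := ℂ) (tfShift z φ) f
  rw [norm_tfShift] at this ⊢
  nlinarith [norm_nonneg φ]

theorem integrable_smul_rankOneTfShift {m : Phase → ℝ} (hm : Integrable m) (φ : L2) :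
    Integrable fun z => (m z : ℂ) • rankOneTfShift φ z := by
  have h := hm.ofReal (𝕜 := ℂ)
  -- the operator space is not separable; measurability comes from the phase space being so
  have : SecondCountableTopologyEither Phase (L2 →L[ℂ] L2) :=
    secondCountableTopologyEither_of_left _ _
  have hsm : StronglyMeasurable (rankOneTfShift φ) :=
    (continuous_rankOneTfShift φ).stronglyMeasurable
  refine Integrable.mono' (hm.norm.mul_const (‖φ‖ * ‖φ‖))
    (h.1.smul hsm.aestronglyMeasurable) (Filter.Eventually.of_forall fun z => ?_)
  rw [norm_smul]
  simp only [Complex.norm_real]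
  gcongr
  exact norm_rankOneTfShift_le φ z

/-- The localization operator as a bounded operator: the integral of its rank-one constituents in
operator norm. For a symbol that is not integrable its value is `0`. -/
def locOpL (m : Phase → ℝ) (φ : L2) : L2 →L[ℂ] L2 :=
  ∫ z : Phase, (m z : ℂ) • rankOneTfShift φ z

theorem locOpL_apply {m : Phase → ℝ} (hm : Integrable m) (φ f : L2) :
    locOpL m φ f = locOp m φ f := by
  rw [locOpL, ContinuousLinearMap.integral_apply (integrable_smul_rankOneTfShift hm φ), locOp]
  refine integral_congr_ae (Filter.Eventually.of_forall fun z => ?_)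
  simp only [mul_smul]
  rfl

/-- Localization operators with integrable symbol are compact, being limits in operator norm of
finite-rank operators. -/
theorem isCompactOperator_locOpL {m : Phase → ℝ} (hm : Integrable m) (φ : L2) :
    IsCompactOperator (locOpL m φ) :=
  integral_mem_of_isClosed (compactOperator (RingHom.id ℂ) L2 L2)
    isClosed_setOfPred_isCompactOperator
    (fun z => (isCompactOperator_rankOneTfShift φ z).smul (m z : ℂ))
    (integrable_smul_rankOneTfShift hm φ)

theorem isSymmetric_locOpL {m : Phase → ℝ} (hm : Integrable m) (φ : L2) :
    (locOpL m φ).IsSymmetric := by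
  intro u f
  change inner ℂ ((locOpL m φ) u) f
    = inner ℂ u ((locOpL m φ) f)
  rw [locOpL_apply hm, locOpL_apply hm, ← inner_conj_symm, inner_locOp hm,
    inner_locOp hm, ← integral_conj]
  refine integral_congr_ae (Filter.Eventually.of_forall fun z => ?_)
  simp only [map_mul, Complex.conj_ofReal, Complex.conj_conj]
  ring

theorem inner_locOp_self {m : Phase → ℝ} (hm : Integrable m) (φ f : L2) :
    inner ℂ f (locOp m φ f) = ((∫ z, m z * ‖stft φ f z‖ ^ 2 : ℝ) : ℂ) := by
  rw [inner_locOp hm, ← integral_complex_ofReal]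
  refine integral_congr_ae (Filter.Eventually.of_forall fun z => ?_)
  simp only [RCLike.conj_mul]
  push_cast
  rfl

/-- A compact positive operator without eigenvalues above `ε` has norm at most `ε`: the norm of a
positive operator belongs to its spectrum, and a nonzero spectral value of a compact operator is an
eigenvalue. -/
theorem IsCompactOperator.norm_le_of_eigenvalues_le {H : Type*} [NormedAddCommGroup H]
    [InnerProductSpace ℂ H] [CompleteSpace H] {S : H →L[ℂ] H} (hc : IsCompactOperator S)
    (hs : S.IsSymmetric) (hp : ∀ x, 0 ≤ (inner ℂ x (S x)).re) {ε : ℝ} (hε : 0 ≤ ε)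
    (hev : ∀ (x : H) (μ : ℝ), ε < μ → S x = (μ : ℂ) • x → x = 0) : ‖S‖ ≤ ε := by
  by_contra! hlt
  have hpos : 0 < ‖S‖ := hε.trans_lt hlt
  have hnt : Nontrivial H := by
    by_contra h
    rw [not_nontrivial_iff_subsingleton] at h
    exact hpos.ne' (by rw [Subsingleton.elim S 0, norm_zero])
  have hspec : ((‖S‖ : ℝ) : ℂ) ∈ spectrum ℂ S := by
    by_contra hns
    obtain ⟨c, hc0, hcx⟩ := S.rayleighQuotient_le_of_norm_mem_resolventSet (𝕜 := ℂ)
      (by simpa [spectrum] using hns)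
    have h1 : ∀ x, |S.rayleighQuotient x| ≤ ‖S‖ - c := fun x => by
      rw [abs_of_nonneg]
      · exact hcx x
      · refine div_nonneg ?_ (by positivity)
        rw [ContinuousLinearMap.reApplyInnerSelf_apply, inner_re_symm]
        exact hp x
    have h2 := ciSup_le h1
    rw [← ContinuousLinearMap.norm_eq_iSup_rayleighQuotient S hs] at h2
    linarith
  rw [← hc.hasEigenvalue_iff_mem_spectrum (by exact_mod_cast hpos.ne')] at hspec
  obtain ⟨x, hx⟩ := hspec.exists_hasEigenvector
  exact hx.2 (hev x ‖S‖ hlt hx.apply_eq_smul)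

/-- A positive operator `S` whose quadratic form is bounded by `M` satisfies `S² ≤ M S`. -/
theorem norm_sq_le_mul_re_inner {H : Type*} [NormedAddCommGroup H] [InnerProductSpace ℂ H]
    {S : H →L[ℂ] H} (hs : S.IsSymmetric)
    (hp : ∀ x, 0 ≤ (inner ℂ x (S x)).re) {M : ℝ} (hM : 0 < M)
    (hb : ∀ x, (inner ℂ x (S x)).re ≤ M * ‖x‖ ^ 2) (u : H) :
    ‖S u‖ ^ 2 ≤ M * (inner ℂ u (S u)).re := by
  -- positivity at `u - M⁻¹ S u`
  have h := hp (u - ((M⁻¹ : ℝ) : ℂ) • S u)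
  have hb' := hb (S u)
  have hsym : inner ℂ u (S (S u)) = inner ℂ (S u) (S u) := (hs u (S u)).symm
  have hself : (inner ℂ (S u) (S u)).re = ‖S u‖ ^ 2 := by
    rw [inner_self_eq_norm_sq_to_K]
    norm_cast
  rw [map_sub, map_smul, inner_sub_left, inner_sub_right, inner_sub_right, inner_smul_left,
    inner_smul_left, inner_smul_right, inner_smul_right, hsym, Complex.conj_ofReal] at h
  simp only [Complex.sub_re, Complex.re_ofReal_mul, hself] at h
  have e : (inner ℂ (S u) (S (S u))).re * (M⁻¹ * M⁻¹) ≤ M⁻¹ * ‖S u‖ ^ 2 := by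
    calc _ ≤ (M * ‖S u‖ ^ 2) * (M⁻¹ * M⁻¹) := by gcongr
      _ = _ := by field_simp
  have e2 : 0 ≤ (inner ℂ u (S u)).re - M⁻¹ * ‖S u‖ ^ 2 := by nlinarith
  have e3 := mul_nonneg hM.le e2
  have e4 : M * (M⁻¹ * ‖S u‖ ^ 2) = ‖S u‖ ^ 2 := by field_simp
  nlinarith

/-- A positive compact operator and a full orthonormal collection of its eigenvectors for the
eigenvalues above `ε`: the coefficients are square summable, they are controlled by the quadratic
form of the operator, and they control the operator up to `ε` times its quadratic form. -/
theorem IsEigenCollection.bounds {T : L2 →L[ℂ] L2} (hc : IsCompactOperator T)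
    (hs : T.IsSymmetric) (hp : ∀ x, 0 ≤ (inner ℂ x (T x)).re) {M : ℝ} (hM : 0 < M)
    (hb : ∀ x, (inner ℂ x (T x)).re ≤ M * ‖x‖ ^ 2) {ε : ℝ} (hε : 0 < ε) {E : Set L2}
    (hE : IsEigenCollection T ε E) (f : L2) :
    Summable (fun e : E => ‖inner ℂ (e : L2) f‖ ^ 2) ∧
    ε * ∑' e : E, ‖inner ℂ (e : L2) f‖ ^ 2 ≤ (inner ℂ f (T f)).re ∧
    ‖T f‖ ^ 2 ≤ M ^ 2 * ∑' e : E, ‖inner ℂ (e : L2) f‖ ^ 2 + ε * (inner ℂ f (T f)).re := by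
  set K : Submodule ℂ L2 := (Submodule.span ℂ E).topologicalClosure with hK
  have hKc : IsClosed (K : Set L2) := Submodule.isClosed_topologicalClosure _
  have : CompleteSpace K := hKc.completeSpace_coe
  have hEK : ∀ e ∈ E, e ∈ K := fun e he =>
    Submodule.le_topologicalClosure _ (Submodule.subset_span he)
  -- the invariance of `K` and of its orthogonal complement
  have hTK : ∀ x ∈ K, T x ∈ K := by
    have h1 : Submodule.span ℂ E ≤ K.comap T.toLinearMap := by
      refine Submodule.span_le.2 fun e he => ?_
      obtain ⟨μ, -, hμ⟩ := hE.eigen e he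
      change T e ∈ K
      rw [hμ]
      exact K.smul_mem _ (hEK e he)
    intro x hx
    exact Submodule.topologicalClosure_minimal _ h1 (hKc.preimage T.continuous) hx
  have hTK' : ∀ x ∈ Kᗮ, T x ∈ Kᗮ := by
    intro x hx
    rw [Submodule.mem_orthogonal]
    intro u hu
    have : inner ℂ u (T x) = inner ℂ (T u) x := (hs u x).symm
    rw [this]
    exact (Submodule.mem_orthogonal _ _).1 hx _ (hTK u hu)
  -- the restriction to the orthogonal complement has no eigenvalue above `ε`
  let S : Kᗮ →L[ℂ] Kᗮ := T.restrict hTK'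
  have hSc : IsCompactOperator S := hc.restrict' hTK'
  have hSs : S.IsSymmetric := hs.restrict_invariant hTK'
  have hSp : ∀ x, 0 ≤ (inner ℂ x (S x)).re := fun x => hp x
  have hSn : ‖S‖ ≤ ε := by
    refine hSc.norm_le_of_eigenvalues_le hSs hSp hε.le fun x μ hμ hx => ?_
    have hx' : T x = (μ : ℂ) • (x : L2) := congrArg Subtype.val hx
    have hxK : (x : L2) ∈ K := hE.complete x μ hμ hx'
    have := (Submodule.mem_orthogonal _ _).1 x.2 x hxK
    exact Subtype.ext (inner_self_eq_zero.1 this)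
  have hSb : ∀ x, (inner ℂ x (S x)).re ≤ ε * ‖x‖ ^ 2 := fun x => by
    calc (inner ℂ x (S x)).re ≤ ‖x‖ * ‖S x‖ := re_inner_le_norm (𝕜 := ℂ) x (S x)
      _ ≤ ‖x‖ * (ε * ‖x‖) := by
        gcongr
        exact S.le_of_opNorm_le hSn x
      _ = _ := by ring
  -- decompose `f = p + q`
  set p : L2 := (K.orthogonalProjectionOnto f : L2) with hpdef
  have hpK : p ∈ K := (K.orthogonalProjectionOnto f).2
  have hqK : f - p ∈ Kᗮ := K.sub_starProjection_mem_orthogonal f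
  set q : L2 := f - p with hqdef
  have hf : f = p + q := by rw [hqdef]; abel
  have horth : ∀ {x y : L2}, x ∈ K → y ∈ Kᗮ → inner ℂ x y = 0 :=
    fun hx hy => (Submodule.mem_orthogonal _ _).1 hy _ hx
  have horth' : ∀ {x y : L2}, x ∈ K → y ∈ Kᗮ → inner ℂ y x = 0 :=
    fun hx hy => inner_eq_zero_symm.1 (horth hx hy)
  have hTq : ‖T q‖ ^ 2 ≤ ε * (inner ℂ q (T q)).re :=
    norm_sq_le_mul_re_inner hSs hSp hε hSb ⟨q, hqK⟩
  have hTp : ‖T p‖ ^ 2 ≤ M * (inner ℂ p (T p)).re := norm_sq_le_mul_re_inner hs hp hM hb p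
  have hTf : ‖T f‖ ^ 2 = ‖T p‖ ^ 2 + ‖T q‖ ^ 2 := by
    rw [hf, map_add, sq, sq, sq]
    exact norm_add_sq_eq_norm_sq_add_norm_sq_of_inner_eq_zero _ _ (horth (hTK p hpK) (hTK' q hqK))
  have hform : (inner ℂ f (T f)).re = (inner ℂ p (T p)).re + (inner ℂ q (T q)).re := by
    rw [hf, map_add, inner_add_left, inner_add_right, inner_add_right,
      horth hpK (hTK' q hqK), horth' (hTK p hpK) hqK]
    simp
  -- expand `p` in the basis `E` of `K`
  have hv : Orthonormal ℂ fun e : E => (⟨e, hEK e e.2⟩ : K) := by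
    have := hE.orthonormal
    classical
    rw [orthonormal_iff_ite] at this ⊢
    exact this
  have hbot : (Submodule.span ℂ (Set.range fun e : E => (⟨e, hEK e e.2⟩ : K)))ᗮ = ⊥ := by
    rw [Submodule.eq_bot_iff]
    intro x hx
    have hx' : Submodule.span ℂ E ≤ (ℂ ∙ (x : L2))ᗮ := by
      refine Submodule.span_le.2 fun e he => ?_
      rw [SetLike.mem_coe, Submodule.mem_orthogonal_singleton_iff_inner_left]
      exact (Submodule.mem_orthogonal _ _).1 hx _ (Submodule.subset_span ⟨⟨e, he⟩, rfl⟩)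
    have hxK := Submodule.topologicalClosure_minimal _ hx' (Submodule.isClosed_orthogonal _) x.2
    rw [Submodule.mem_orthogonal_singleton_iff_inner_left] at hxK
    exact Subtype.ext (inner_self_eq_zero.1 hxK)
  have hsum := (HilbertBasis.mkOfOrthogonalEqBot hv hbot).hasSum_orthogonalProjectionOnto f
  rw [HilbertBasis.coe_mkOfOrthogonalEqBot] at hsum
  have hsum' : HasSum (fun e : E => inner ℂ (e : L2) f • (e : L2)) p :=
    hsum.mapL K.subtypeL
  have hpe : ∀ e : E, inner ℂ p (e : L2) = starRingEnd ℂ (inner ℂ (e : L2) f) := by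
    intro e
    rw [inner_conj_symm, hf, inner_add_left, horth' (hEK e e.2) hqK, add_zero]
  have h1 : HasSum (fun e : E => ‖inner ℂ (e : L2) f‖ ^ 2) (‖p‖ ^ 2) := by
    have := Complex.reCLM.hasSum (hsum'.mapL (innerSL ℂ p))
    have e0 : Complex.reCLM (innerSL ℂ p p) = ‖p‖ ^ 2 := by
      rw [innerSL_apply_apply, inner_self_eq_norm_sq_to_K]
      norm_cast
    rw [e0] at this
    convert this using 2 with e
    rw [innerSL_apply_apply, inner_smul_right, hpe, RCLike.mul_conj, Complex.reCLM_apply]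
    norm_cast
  have h2 : ε * ‖p‖ ^ 2 ≤ (inner ℂ p (T p)).re := by
    have := Complex.reCLM.hasSum ((hsum'.mapL T).mapL (innerSL ℂ p))
    refine hasSum_le (fun e => ?_) (h1.mul_left ε) this
    obtain ⟨μ, hμ, hTe⟩ := hE.eigen e e.2
    rw [innerSL_apply_apply, map_smul, hTe, inner_smul_right, inner_smul_right, hpe,
      mul_left_comm, RCLike.mul_conj, Complex.reCLM_apply, Complex.re_ofReal_mul]
    have hsq : (((‖inner ℂ (e : L2) f‖ : ℝ) : ℂ) ^ 2).re = ‖inner ℂ (e : L2) f‖ ^ 2 := by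
      norm_cast
    exact (mul_le_mul_of_nonneg_right hμ.le (by positivity)).trans_eq
      (congrArg (μ * ·) hsq.symm)
  refine ⟨h1.summable, ?_, ?_⟩
  · rw [h1.tsum_eq, hform]
    have := hp q
    linarith
  · rw [h1.tsum_eq, hTf, hform]
    have hpb := hb p
    have := hp p
    nlinarith

/-! ### Sums over relatively separated sets -/

theorem RelativelySeparated.countable {Γ : Set Phase} (h : RelativelySeparated Γ) :
    Countable Γ := by
  obtain ⟨N, hN⟩ := h
  rw [Set.countable_coe_iff]
  have hsub : Γ ⊆ ⋃ n : ℕ, Γ ∩ Metric.closedBall (TopologicalSpace.denseSeq Phase n) 1 := by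
    intro γ hγ
    obtain ⟨n, hn⟩ := (TopologicalSpace.denseRange_denseSeq Phase).exists_dist_lt γ one_pos
    exact Set.mem_iUnion.2 ⟨n, hγ, Metric.mem_closedBall.2 hn.le⟩
  refine (Set.countable_iUnion fun n => ?_).mono hsub
  exact (Set.finite_of_encard_le_coe (hN _)).countable

/-- The overlap of the unit balls around the points of `Γ` counts the points near `w`. -/
theorem tsum_indicator_closedBall (Γ : Set Phase) (w : Phase) :
    ∑' γ : Γ, (Metric.closedBall (γ : Phase) 1).indicator (1 : Phase → ℝ≥0∞) w
      = ((Γ ∩ Metric.closedBall w 1).encard : ℝ≥0∞) := by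
  have h : ∀ γ : Γ, (Metric.closedBall (γ : Phase) 1).indicator (1 : Phase → ℝ≥0∞) w
      = (Metric.closedBall w 1).indicator (1 : Phase → ℝ≥0∞) γ := by
    intro γ
    simp only [Set.indicator, Metric.mem_closedBall, dist_comm w, Pi.one_apply]
  simp only [h]
  rw [tsum_subtype Γ ((Metric.closedBall w 1).indicator (1 : Phase → ℝ≥0∞)),
    Set.indicator_indicator, ← tsum_subtype]
  simp only [Pi.one_apply]
  exact ENNReal.tsum_set_one _

theorem one_add_norm_sub_rpow_le {r : ℝ} (hr : 0 ≤ r) {z γ w : Phase} (hw : dist w γ ≤ 1) :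
    (1 + ‖z - γ‖) ^ (-r) ≤ 2 ^ r * (1 + ‖z - w‖) ^ (-r) := by
  have h1 : ‖z - w‖ ≤ ‖z - γ‖ + 1 := by
    have := dist_triangle_right z w γ
    rw [dist_eq_norm, dist_eq_norm] at this
    linarith
  have h2 : (1 + ‖z - w‖) / 2 ≤ 1 + ‖z - γ‖ := by
    have := norm_nonneg (z - γ)
    linarith
  have h3 : (2 : ℝ) ^ r * (1 + ‖z - w‖) ^ (-r) = ((1 + ‖z - w‖) / 2) ^ (-r) := by
    rw [Real.div_rpow (by positivity) (by norm_num), Real.rpow_neg (by norm_num : (0 : ℝ) ≤ 2),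
      div_inv_eq_mul, mul_comm]
  rw [h3]
  exact Real.rpow_le_rpow_of_nonpos (by positivity) h2 (by linarith)

/-- Polynomially decaying functions of integrable order `r > 2 = dim ℝ²` are summable over the
translates by a relatively separated set, uniformly in the base point: compare the sum with an
integral over unit balls, which overlap boundedly often. -/
theorem RelativelySeparated.tsum_le {Γ : Set Phase} (h : RelativelySeparated Γ) {r : ℝ}
    (hr : 2 < r) : ∃ M : ℝ, 0 ≤ M ∧
      ∀ z : Phase, ∑' γ : Γ, ENNReal.ofReal ((1 + ‖z - γ‖) ^ (-r)) ≤ ENNReal.ofReal M := by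
  have := h.countable
  obtain ⟨N, hN⟩ := h
  let G : Phase → ℝ≥0∞ := fun w => ENNReal.ofReal (2 ^ r * (1 + ‖w‖) ^ (-r))
  have hG : Measurable G := by fun_prop
  have hGfin : ∫⁻ w, G w < ∞ := by
    have hint : Integrable fun w : Phase => 2 ^ r * (1 + ‖w‖) ^ (-r) :=
      (integrable_one_add_norm (by simpa using hr)).const_mul _
    refine lt_of_le_of_lt (lintegral_mono fun w => ?_) hint.2
    exact Real.ofReal_le_enorm _
  let c : ℝ≥0∞ := volume (Metric.closedBall (0 : Phase) 1)
  have hc0 : c ≠ 0 := (Metric.measure_closedBall_pos volume _ one_pos).ne'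
  have hct : c ≠ ∞ := measure_closedBall_lt_top.ne
  have hvol : ∀ γ : Phase, volume (Metric.closedBall γ 1) = c := fun γ =>
    Measure.addHaar_closedBall_center volume γ 1
  have key : ∀ z : Phase, c * ∑' γ : Γ, ENNReal.ofReal ((1 + ‖z - γ‖) ^ (-r))
      ≤ N * ∫⁻ w, G w := by
    intro z
    calc c * ∑' γ : Γ, ENNReal.ofReal ((1 + ‖z - γ‖) ^ (-r))
        = ∑' γ : Γ, ∫⁻ w in Metric.closedBall (γ : Phase) 1,
            ENNReal.ofReal ((1 + ‖z - γ‖) ^ (-r)) := by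
          rw [← ENNReal.tsum_mul_left]
          refine tsum_congr fun γ => ?_
          rw [setLIntegral_const, hvol, mul_comm]
      _ ≤ ∑' γ : Γ, ∫⁻ w, (Metric.closedBall (γ : Phase) 1).indicator 1 w * G (z - w) := by
          refine ENNReal.tsum_le_tsum fun γ => ?_
          rw [← lintegral_indicator Metric.isClosed_closedBall.measurableSet]
          refine lintegral_mono fun w => ?_
          by_cases hw : w ∈ Metric.closedBall (γ : Phase) 1
          · simp only [Set.indicator_of_mem hw, Pi.one_apply, one_mul]
            exact ENNReal.ofReal_le_ofReal (one_add_norm_sub_rpow_le (by linarith) hw)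
          · simp only [Set.indicator_of_notMem hw, zero_mul, le_refl]
      _ = ∫⁻ w, (∑' γ : Γ, (Metric.closedBall (γ : Phase) 1).indicator 1 w) * G (z - w) := by
          simp only [← ENNReal.tsum_mul_right]
          refine (lintegral_tsum fun γ => ?_).symm
          exact ((measurable_one.indicator Metric.isClosed_closedBall.measurableSet).mul
            (hG.comp (measurable_const.sub measurable_id))).aemeasurable
      _ ≤ ∫⁻ w, N * G (z - w) := by
          refine lintegral_mono fun w => ?_
          gcongr
          rw [tsum_indicator_closedBall]
          exact (ENat.toENNReal_le.2 (hN w)).trans_eq (ENat.toENNReal_coe N)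
      _ = N * ∫⁻ w, G w := by
          rw [lintegral_const_mul' _ _ (by simp), lintegral_sub_left_eq_self G z]
  refine ⟨(c⁻¹ * (N * ∫⁻ w, G w)).toReal, ENNReal.toReal_nonneg, fun z => ?_⟩
  rw [ENNReal.ofReal_toReal]
  · rw [mul_comm c⁻¹, ← div_eq_mul_inv, ENNReal.le_div_iff_mul_le (Or.inl hc0) (Or.inl hct),
      mul_comm]
    exact key z
  · exact ENNReal.mul_ne_top (ENNReal.inv_ne_top.2 hc0) (ENNReal.mul_ne_top (by simp) hGfin.ne)

/-- Comparison of the Euclidean norm with the sup norm `‖z‖` of the product space. -/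
theorem one_add_norm_sq_le (z : Phase) :
    (1 + ‖z‖) ^ 2 / 2 ≤ 1 + (z.1 ^ 2 + z.2 ^ 2) := by
  have h : ‖z‖ ^ 2 ≤ z.1 ^ 2 + z.2 ^ 2 := by
    rw [Prod.norm_def]
    rcases max_choice ‖z.1‖ ‖z.2‖ with h | h <;> rw [h, Real.norm_eq_abs, sq_abs] <;> nlinarith
  nlinarith [sq_nonneg (1 - ‖z‖)]

/-- The decay of a well-spread family, in terms of the sup norm of the product space. -/
theorem WellSpread.exists_decay {Γ : Set Phase} {η : Γ → Phase → ℝ} (hη : WellSpread Γ η) :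
    ∃ C r : ℝ, 0 ≤ C ∧ 2 < r ∧ ∀ (γ : Γ) (z : Phase), η γ z ≤ C * (1 + ‖z - γ‖) ^ (-r) := by
  obtain ⟨g, -, -, ⟨C, s, hs, hC⟩, hg⟩ := hη.envelope
  have hC0 : 0 ≤ C := by
    have h0 := (abs_nonneg (g 0)).trans (hC 0)
    simpa using h0
  refine ⟨C * 2 ^ s, 2 * s, by positivity, by linarith, fun γ z => ?_⟩
  have h1 := one_add_norm_sq_le (z - γ)
  have h2 : (1 + ((z - γ).1 ^ 2 + (z - γ).2 ^ 2)) ^ (-s) ≤ ((1 + ‖z - γ‖) ^ 2 / 2) ^ (-s) :=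
    Real.rpow_le_rpow_of_nonpos (by positivity) h1 (by linarith)
  have h3 : ((1 + ‖z - γ‖) ^ 2 / 2) ^ (-s) = 2 ^ s * (1 + ‖z - γ‖) ^ (-(2 * s)) := by
    rw [Real.div_rpow (by positivity) (by norm_num), Real.rpow_neg (by norm_num : (0 : ℝ) ≤ 2),
      div_inv_eq_mul, mul_comm, ← Real.rpow_natCast, ← Real.rpow_mul (by positivity)]
    congr 2
    push_cast
    ring
  calc η γ z ≤ |η γ z| := le_abs_self _
    _ ≤ g (z - γ) := hg γ z
    _ ≤ |g (z - γ)| := le_abs_self _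
    _ ≤ _ := hC (z - γ)
    _ ≤ C * (2 ^ s * (1 + ‖z - γ‖) ^ (-(2 * s))) := by
      rw [← h3]
      gcongr
    _ = _ := by ring

/-- The Gaussian `z ↦ e^{-πδ²|z|²}` on phase space, with the Euclidean norm of `z`. -/
def phaseGauss (δ : ℝ) (z : Phase) : ℝ := Real.exp (-(Real.pi * (δ ^ 2 * (z.1 ^ 2 + z.2 ^ 2))))

theorem phaseGauss_pos (δ : ℝ) (z : Phase) : 0 < phaseGauss δ z := Real.exp_pos _

theorem phaseGauss_le_one (δ : ℝ) (z : Phase) : phaseGauss δ z ≤ 1 :=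
  Real.exp_le_one_iff.2 (by have := Real.pi_pos; simp only [Left.neg_nonpos_iff]; positivity)

@[fun_prop]
theorem continuous_phaseGauss (δ : ℝ) : Continuous (phaseGauss δ) := by
  unfold phaseGauss
  fun_prop

theorem sq_add_sq_le (z : Phase) : z.1 ^ 2 + z.2 ^ 2 ≤ 2 * (1 + ‖z‖) ^ 2 := by
  have h1 : z.1 ^ 2 ≤ ‖z‖ ^ 2 := by
    rw [← sq_abs z.1]; gcongr; exact norm_fst_le z
  have h2 : z.2 ^ 2 ≤ ‖z‖ ^ 2 := by
    rw [← sq_abs z.2]; gcongr; exact norm_snd_le z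
  nlinarith [norm_nonneg z]

/-- The Gaussian deviates from `1` by little where `‖z‖` is small compared with `1 / δ`. The small
exponent `a` leaves part of the decay of a well-spread family for summation. -/
theorem one_sub_phaseGauss_le {δ a : ℝ} (ha : 0 < a) (ha1 : a ≤ 1) (z : Phase) :
    1 - phaseGauss δ z ≤ (2 * Real.pi * δ ^ 2) ^ a * (1 + ‖z‖) ^ (2 * a) := by
  have hπ := Real.pi_pos
  set x := Real.pi * (δ ^ 2 * (z.1 ^ 2 + z.2 ^ 2)) with hx
  have hx0 : 0 ≤ x := by positivity
  have h1 : 1 - phaseGauss δ z ≤ x ^ a := by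
    rcases le_total x 1 with h | h
    · calc 1 - phaseGauss δ z ≤ x := by
            have := Real.add_one_le_exp (-x)
            rw [phaseGauss]
            linarith
        _ = x ^ (1 : ℝ) := (Real.rpow_one x).symm
        _ ≤ x ^ a := Real.rpow_le_rpow_of_exponent_ge' hx0 h ha.le ha1
    · calc 1 - phaseGauss δ z ≤ 1 := by linarith [phaseGauss_pos δ z]
        _ ≤ x ^ a := Real.one_le_rpow h ha.le
  refine h1.trans ?_
  have h2 : x ≤ (2 * Real.pi * δ ^ 2) * (1 + ‖z‖) ^ 2 := by
    calc x ≤ Real.pi * (δ ^ 2 * (2 * (1 + ‖z‖) ^ 2)) := by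
          rw [hx]; gcongr; exact sq_add_sq_le z
      _ = _ := by ring
  calc x ^ a ≤ ((2 * Real.pi * δ ^ 2) * (1 + ‖z‖) ^ 2) ^ a := by gcongr
    _ = _ := by
      rw [Real.mul_rpow (by positivity) (by positivity), ← Real.rpow_natCast (1 + ‖z‖),
        ← Real.rpow_mul (by positivity)]
      norm_cast

/-- The mass of a well-spread family away from its centres tends to zero uniformly as the Gaussian
cut-off widens. -/
theorem WellSpread.eventually_tail_le {Γ : Set Phase} {η : Γ → Phase → ℝ} (hη : WellSpread Γ η)
    {τ : ℝ} (hτ : 0 < τ) : ∀ᶠ δ in nhdsWithin (0 : ℝ) (Set.Ioi 0), ∀ z : Phase,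
      ∑' γ : Γ, ENNReal.ofReal (η γ z * (1 - phaseGauss δ (z - γ))) ≤ ENNReal.ofReal τ := by
  obtain ⟨C, r, hC, hr, hdec⟩ := hη.exists_decay
  -- small enough for the order `r - 2 a` to remain integrable
  set a : ℝ := min 1 ((r - 2) / 4) with ha
  have ha0 : 0 < a := lt_min one_pos (by linarith)
  have ha1 : a ≤ 1 := min_le_left _ _
  have har : 2 < r - 2 * a := by
    have := min_le_right (1 : ℝ) ((r - 2) / 4)
    linarith
  obtain ⟨M, hM0, hM⟩ := hη.separated.tsum_le har
  have hlim : Filter.Tendsto (fun δ : ℝ => C * (2 * Real.pi * δ ^ 2) ^ a * M)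
      (nhdsWithin 0 (Set.Ioi 0)) (nhds 0) := by
    have hc : Continuous fun δ : ℝ => C * (2 * Real.pi * δ ^ 2) ^ a * M := by
      refine (continuous_const.mul (Continuous.rpow_const (by fun_prop) fun _ => Or.inr ha0.le)).mul
        continuous_const
    have h0 := hc.tendsto 0
    simp only [ne_eq, OfNat.ofNat_ne_zero, not_false_eq_true, zero_pow, mul_zero,
      Real.zero_rpow ha0.ne', zero_mul] at h0
    exact h0.mono_left nhdsWithin_le_nhds
  filter_upwards [hlim.eventually_lt_const hτ] with δ hδ z
  have hterm : ∀ γ : Γ, η γ z * (1 - phaseGauss δ (z - γ))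
      ≤ C * (2 * Real.pi * δ ^ 2) ^ a * (1 + ‖z - γ‖) ^ (-(r - 2 * a)) := by
    intro γ
    have h1 := one_sub_phaseGauss_le (δ := δ) ha0 ha1 (z - γ)
    have h2 : 0 ≤ 1 - phaseGauss δ (z - γ) := by linarith [phaseGauss_le_one δ (z - γ)]
    have hpos : 0 < 1 + ‖z - γ‖ := by positivity
    calc η γ z * (1 - phaseGauss δ (z - γ))
        ≤ (C * (1 + ‖z - γ‖) ^ (-r)) * ((2 * Real.pi * δ ^ 2) ^ a * (1 + ‖z - γ‖) ^ (2 * a)) := by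
          gcongr
          exact hdec γ z
      _ = C * (2 * Real.pi * δ ^ 2) ^ a * ((1 + ‖z - γ‖) ^ (-r) * (1 + ‖z - γ‖) ^ (2 * a)) := by
          ring
      _ = _ := by
          rw [← Real.rpow_add hpos]
          congr 2
          ring
  have hcoef : 0 ≤ C * (2 * Real.pi * δ ^ 2) ^ a := by positivity
  calc ∑' γ : Γ, ENNReal.ofReal (η γ z * (1 - phaseGauss δ (z - γ)))
      ≤ ∑' γ : Γ, ENNReal.ofReal (C * (2 * Real.pi * δ ^ 2) ^ a)
          * ENNReal.ofReal ((1 + ‖z - γ‖) ^ (-(r - 2 * a))) := by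
        refine ENNReal.tsum_le_tsum fun γ => ?_
        rw [← ENNReal.ofReal_mul hcoef]
        exact ENNReal.ofReal_le_ofReal (hterm γ)
    _ ≤ ENNReal.ofReal (C * (2 * Real.pi * δ ^ 2) ^ a) * ENNReal.ofReal M := by
        rw [ENNReal.tsum_mul_left]
        gcongr
        exact hM z
    _ ≤ ENNReal.ofReal τ := by
        rw [← ENNReal.ofReal_mul hcoef]
        exact ENNReal.ofReal_le_ofReal hδ.le

/-- The exponent `-4` is one that is integrable over phase space. -/
theorem exists_phaseGauss_sq_le {δ : ℝ} (hδ : 0 < δ) :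
    ∃ K : ℝ, 0 ≤ K ∧ ∀ z : Phase, phaseGauss δ z ^ 2 ≤ K * (1 + ‖z‖) ^ (-4 : ℝ) := by
  have hπ := Real.pi_pos
  set c : ℝ := min 1 (Real.pi * δ ^ 2) with hc
  have hc0 : 0 < c := lt_min one_pos (by positivity)
  refine ⟨(2 / c) ^ 2, by positivity, fun z => ?_⟩
  have hn := norm_nonneg z
  have h1 : ‖z‖ ^ 2 ≤ z.1 ^ 2 + z.2 ^ 2 := by
    rw [Prod.norm_def]
    rcases max_choice ‖z.1‖ ‖z.2‖ with h | h <;> rw [h, Real.norm_eq_abs, sq_abs] <;> nlinarith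
  -- `c (1 + ‖z‖)² ≤ 2 (1 + c ‖z‖²) ≤ 2 e^{c ‖z‖²}`, as `c ≤ 1`
  have h2 : phaseGauss δ z * (1 + ‖z‖) ^ 2 ≤ 2 / c := by
    have h3 : phaseGauss δ z ≤ Real.exp (-(c * ‖z‖ ^ 2)) := by
      rw [phaseGauss, Real.exp_le_exp, neg_le_neg_iff]
      calc c * ‖z‖ ^ 2 ≤ (Real.pi * δ ^ 2) * (z.1 ^ 2 + z.2 ^ 2) := by
            gcongr
            exact min_le_right _ _
        _ = _ := by ring
    have h4 : c * (1 + ‖z‖) ^ 2 ≤ 2 * Real.exp (c * ‖z‖ ^ 2) := by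
      have h5 := Real.add_one_le_exp (c * ‖z‖ ^ 2)
      have h6 : c ≤ 1 := min_le_left _ _
      nlinarith [mul_nonneg hc0.le (sq_nonneg (1 - ‖z‖))]
    rw [Real.exp_neg] at h3
    have h7 := Real.exp_pos (c * ‖z‖ ^ 2)
    rw [le_div_iff₀ hc0]
    calc phaseGauss δ z * (1 + ‖z‖) ^ 2 * c = phaseGauss δ z * (c * (1 + ‖z‖) ^ 2) := by ring
      _ ≤ (Real.exp (c * ‖z‖ ^ 2))⁻¹ * (2 * Real.exp (c * ‖z‖ ^ 2)) := by gcongr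
      _ = 2 := by field_simp
  have h8 : (1 + ‖z‖) ^ (-4 : ℝ) = ((1 + ‖z‖) ^ 4)⁻¹ := by
    rw [Real.rpow_neg (by positivity)]
    norm_cast
  rw [h8, ← div_eq_mul_inv, le_div_iff₀ (by positivity)]
  have h9 : 0 ≤ phaseGauss δ z * (1 + ‖z‖) ^ 2 :=
    mul_nonneg (phaseGauss_pos δ z).le (by positivity)
  calc phaseGauss δ z ^ 2 * (1 + ‖z‖) ^ 4 = (phaseGauss δ z * (1 + ‖z‖) ^ 2) ^ 2 := by ring
    _ ≤ (2 / c) ^ 2 := by gcongr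

theorem RelativelySeparated.tsum_phaseGauss_le {Γ : Set Phase} (h : RelativelySeparated Γ)
    {δ : ℝ} (hδ : 0 < δ) : ∃ M : ℝ, 0 ≤ M ∧
      ∀ z : Phase, ∑' γ : Γ, ENNReal.ofReal (phaseGauss δ (z - γ) ^ 2) ≤ ENNReal.ofReal M := by
  obtain ⟨K, hK0, hK⟩ := exists_phaseGauss_sq_le hδ
  obtain ⟨M, hM0, hM⟩ := h.tsum_le (r := 4) (by norm_num)
  refine ⟨K * M, by positivity, fun z => ?_⟩
  calc ∑' γ : Γ, ENNReal.ofReal (phaseGauss δ (z - γ) ^ 2)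
      ≤ ∑' γ : Γ, ENNReal.ofReal K * ENNReal.ofReal ((1 + ‖z - γ‖) ^ (-4 : ℝ)) := by
        refine ENNReal.tsum_le_tsum fun γ => ?_
        rw [← ENNReal.ofReal_mul hK0]
        exact ENNReal.ofReal_le_ofReal (hK _)
    _ ≤ ENNReal.ofReal (K * M) := by
        rw [ENNReal.tsum_mul_left, ENNReal.ofReal_mul hK0]
        gcongr
        exact hM z

/-! ### Gaussian cut-offs as averages of symplectic characters -/

/-- The probability measure on phase space with density `e^{-π|z|²}`. -/
def phaseGaussMeasure : Measure Phase :=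
  (ProbabilityTheory.gaussianReal 0 (Real.toNNReal (2 * Real.pi)⁻¹)).prod
    (ProbabilityTheory.gaussianReal 0 (Real.toNNReal (2 * Real.pi)⁻¹))

instance : IsProbabilityMeasure phaseGaussMeasure := by
  unfold phaseGaussMeasure
  infer_instance

/-- The Gaussian `e^{-πt²}` is its own Fourier transform. -/
theorem integral_exp_gaussianReal (t : ℝ) :
    ∫ x : ℝ, Complex.exp ((2 * Real.pi * (t * x) : ℝ) * Complex.I)
      ∂(ProbabilityTheory.gaussianReal 0 (Real.toNNReal (2 * Real.pi)⁻¹))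
      = ((Real.exp (-(Real.pi * t ^ 2)) : ℝ) : ℂ) := by
  have hπ := Real.pi_pos
  have h := ProbabilityTheory.charFun_gaussianReal (μ := 0) (v := Real.toNNReal (2 * Real.pi)⁻¹)
    (2 * Real.pi * t)
  rw [charFun_apply_real] at h
  have e : ∀ x : ℝ, ((2 * Real.pi * (t * x) : ℝ) : ℂ) * Complex.I
      = ((2 * Real.pi * t : ℝ) : ℂ) * x * Complex.I := by
    intro x; push_cast; ring
  simp only [e]
  rw [h, Real.coe_toNNReal _ (by positivity)]
  push_cast
  congr 1
  have hπ' : (Real.pi : ℂ) ≠ 0 := by exact_mod_cast hπ.ne'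
  field_simp
  ring

/-- The Gaussian cut-off is a superposition of slowly varying symplectic characters. -/
theorem phaseGauss_eq_integral (δ : ℝ) (z : Phase) :
    ((phaseGauss δ z : ℝ) : ℂ) = ∫ v, sympChar (δ • v) z ∂phaseGaussMeasure := by
  have e : ∀ v : Phase, sympChar (δ • v) z
      = Complex.exp ((2 * Real.pi * ((-(δ * z.2)) * v.1) : ℝ) * Complex.I)
        * Complex.exp ((2 * Real.pi * ((δ * z.1) * v.2) : ℝ) * Complex.I) := by
    intro v
    rw [sympChar, ← Complex.exp_add]
    congr 1
    simp only [Prod.smul_fst, Prod.smul_snd, smul_eq_mul]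
    push_cast
    ring
  simp only [e]
  rw [phaseGaussMeasure, integral_prod_mul
    (fun x : ℝ => Complex.exp ((2 * Real.pi * ((-(δ * z.2)) * x) : ℝ) * Complex.I))
    (fun x : ℝ => Complex.exp ((2 * Real.pi * ((δ * z.1) * x) : ℝ) * Complex.I)),
    integral_exp_gaussianReal, integral_exp_gaussianReal, ← Complex.ofReal_mul, ← Real.exp_add,
    phaseGauss]
  congr 2
  ring

theorem integrable_phaseGauss {δ : ℝ} (hδ : 0 < δ) : Integrable (phaseGauss δ) := by
  have hπ := Real.pi_pos
  have h := integrable_exp_neg_mul_sq (b := Real.pi * δ ^ 2) (by positivity)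
  refine (h.mul_prod h).congr (Filter.Eventually.of_forall fun z => ?_)
  simp only [phaseGauss, ← Real.exp_add]
  congr 1
  ring

/-- Localization with a Gaussian symbol is a superposition of time-frequency shifts. -/
theorem inner_locOp_phaseGauss {δ : ℝ} (hδ : 0 < δ) (γ : Phase) (θ u f : L2) :
    inner ℂ u (locOp (fun z => phaseGauss δ (z - γ)) θ f)
      = ∫ v, sympChar (δ • v) (-γ) * (inner ℂ u (tfShift (δ • v) f) * inner ℂ (tfShift (δ • v) θ) θ)
          ∂phaseGaussMeasure := by
  have hint : Integrable fun z => starRingEnd ℂ (stft θ u z) * stft θ f z :=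
    integrable_stft_mul_conj_stft _ _ _ _
  have hsc : Continuous fun p : Phase × Phase => sympChar (δ • p.2) (p.1 - γ) :=
    continuous_sympChar.comp (by fun_prop : Continuous fun p : Phase × Phase => (δ • p.2, p.1 - γ))
  have hint2 : Integrable (fun p : Phase × Phase =>
      sympChar (δ • p.2) (p.1 - γ) * (starRingEnd ℂ (stft θ u p.1) * stft θ f p.1))
      (volume.prod phaseGaussMeasure) := by
    refine (hint.comp_fst phaseGaussMeasure).bdd_mul hsc.aestronglyMeasurable (c := 1) ?_
    exact Filter.Eventually.of_forall fun p => (norm_sympChar _ _).le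
  rw [inner_locOp ((integrable_phaseGauss hδ).comp_sub_right γ)]
  simp only [phaseGauss_eq_integral, ← integral_mul_const]
  rw [integral_integral_swap hint2]
  refine integral_congr_ae (Filter.Eventually.of_forall fun v => ?_)
  simp only
  rw [← integral_conj_stft_mul_stft, ← integral_const_mul]
  refine integral_congr_ae (Filter.Eventually.of_forall fun z => ?_)
  simp only [sympChar_sub, stft_tfShift_tfShift]
  ring

/-- The defect of `ψ` from being an eigenvector of the time-frequency shift by `v`, where the
eigenvalue is taken from the reference window `θ`. -/
def shiftDefect (θ ψ : L2) (v : Phase) : L2 :=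
  tfShift v ψ - (starRingEnd ℂ (inner ℂ (tfShift v θ) θ)) • ψ

theorem continuous_shiftDefect (θ ψ : L2) : Continuous (shiftDefect θ ψ) := by
  have h : ∀ χ : L2, Continuous fun v : Phase => tfShift v χ := fun χ =>
    continuous_tfShift_comp continuous_id continuous_const
  unfold shiftDefect
  exact (h ψ).sub ((Complex.continuous_conj.comp
    (Continuous.inner (𝕜 := ℂ) (h θ) continuous_const)).smul continuous_const)

theorem shiftDefect_zero {θ : L2} (hθ : ‖θ‖ = 1) (ψ : L2) : shiftDefect θ ψ 0 = 0 := by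
  rw [shiftDefect, tfShift_zero, tfShift_zero, inner_self_eq_norm_sq_to_K, hθ]
  simp

theorem norm_shiftDefect_le {θ : L2} (hθ : ‖θ‖ = 1) (ψ : L2) (v : Phase) :
    ‖shiftDefect θ ψ v‖ ≤ 2 * ‖ψ‖ := by
  have h := norm_inner_le_norm (𝕜 := ℂ) (tfShift v θ) θ
  rw [norm_tfShift, hθ, one_mul] at h
  calc ‖shiftDefect θ ψ v‖ ≤ ‖tfShift v ψ‖ + ‖(starRingEnd ℂ (inner ℂ (tfShift v θ) θ)) • ψ‖ :=
        norm_sub_le _ _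
    _ ≤ ‖ψ‖ + 1 * ‖ψ‖ := by
        rw [norm_tfShift, norm_smul, RCLike.norm_conj]
        gcongr
    _ = 2 * ‖ψ‖ := by ring

/-- Localizing a short-time Fourier transform with a Gaussian cut-off and taking the short-time
Fourier transform of the localized function differ only by short-time Fourier transforms with
respect to shift defects of the window. -/
theorem phaseGauss_mul_stft_sub {δ : ℝ} (hδ : 0 < δ) (γ : Phase) (θ ψ f : L2) (z : Phase) :
    (phaseGauss δ (z - γ) : ℂ) * stft ψ f z
        - stft ψ (locOp (fun z => phaseGauss δ (z - γ)) θ f) z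
      = ∫ v, sympChar (δ • v) (-γ) * stft (shiftDefect θ ψ (δ • v)) (tfShift (δ • v) f) z
          ∂phaseGaussMeasure := by
  have hsh : Continuous fun v : Phase => δ • v := by fun_prop
  have hts : ∀ χ : L2, Continuous fun v : Phase => tfShift (δ • v) χ := fun χ =>
    continuous_tfShift_comp hsh continuous_const
  have hsc : ∀ w : Phase, Continuous fun v : Phase => sympChar (δ • v) w := fun w =>
    continuous_sympChar.comp (by fun_prop : Continuous fun v : Phase => (δ • v, w))
  rw [phaseGauss_eq_integral, ← integral_mul_const, stft, stft, inner_locOp_phaseGauss hδ]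
  rw [← integral_sub]
  · refine integral_congr_ae (Filter.Eventually.of_forall fun v => ?_)
    simp only
    rw [shiftDefect, stft_sub_left, stft_smul_left, Complex.conj_conj, stft_tfShift_tfShift,
      sympChar_sub, stft, stft]
    ring
  · refine Integrable.of_bound ((hsc _).mul continuous_const).aestronglyMeasurable
      (‖inner ℂ (tfShift z ψ) f‖) (Filter.Eventually.of_forall fun v => ?_)
    rw [norm_mul, norm_sympChar, one_mul]
  · refine Integrable.of_bound (C := ‖ψ‖ * ‖f‖ * (‖θ‖ * ‖θ‖)) ((hsc _).mul
      ((Continuous.inner (𝕜 := ℂ) continuous_const (hts f)).mul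
        (Continuous.inner (𝕜 := ℂ) (hts θ) continuous_const))).aestronglyMeasurable
      (Filter.Eventually.of_forall fun v => ?_)
    rw [norm_mul, norm_sympChar, one_mul, norm_mul]
    have h1 := norm_inner_le_norm (𝕜 := ℂ) (tfShift z ψ) (tfShift (δ • v) f)
    have h2 := norm_inner_le_norm (𝕜 := ℂ) (tfShift (δ • v) θ) θ
    rw [norm_tfShift, norm_tfShift] at h1
    rw [norm_tfShift] at h2
    gcongr

/-- **Jensen's inequality** for the square. -/
theorem enorm_integral_sq_le {α : Type*} [MeasurableSpace α] (ν : Measure α)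
    [IsProbabilityMeasure ν] {h : α → ℂ} (hm : AEStronglyMeasurable h ν) :
    ‖∫ v, h v ∂ν‖ₑ ^ 2 ≤ ∫⁻ v, ‖h v‖ₑ ^ 2 ∂ν := by
  have h1 : ‖∫ v, h v ∂ν‖ₑ ≤ eLpNorm h 2 ν := by
    refine (enorm_integral_le_lintegral_enorm h).trans ?_
    rw [← eLpNorm_one_eq_lintegral_enorm]
    exact eLpNorm_le_eLpNorm_of_exponent_le (by norm_num) hm
  have h2 : eLpNorm h 2 ν ^ 2 = ∫⁻ v, ‖h v‖ₑ ^ 2 ∂ν := by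
    rw [eLpNorm_eq_lintegral_rpow_enorm_toReal (by simp) (by simp)]
    simp only [ENNReal.toReal_ofNat, ENNReal.rpow_ofNat]
    rw [← ENNReal.rpow_natCast, ← ENNReal.rpow_mul]
    norm_num
  rw [← h2]
  gcongr

theorem enorm_phaseGauss_mul_stft_sub_sq_le {δ : ℝ} (hδ : 0 < δ) (γ : Phase) (θ ψ f : L2)
    (z : Phase) :
    ‖(phaseGauss δ (z - γ) : ℂ) * stft ψ f z
        - stft ψ (locOp (fun z => phaseGauss δ (z - γ)) θ f) z‖ₑ ^ 2
      ≤ ∫⁻ v, ‖stft (shiftDefect θ ψ (δ • v)) (tfShift (δ • v) f) z‖ₑ ^ 2 ∂phaseGaussMeasure := by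
  have hsh : Continuous fun v : Phase => δ • v := by fun_prop
  have hsc : Continuous fun v : Phase => sympChar (δ • v) (-γ) :=
    continuous_sympChar.comp (by fun_prop : Continuous fun v : Phase => (δ • v, -γ))
  rw [phaseGauss_mul_stft_sub hδ]
  refine (enorm_integral_sq_le _ ?_).trans_eq ?_
  · exact (hsc.mul (continuous_stft_comp ((continuous_shiftDefect θ ψ).comp hsh)
      (continuous_tfShift_comp hsh continuous_const) continuous_const)).aestronglyMeasurable
  · refine lintegral_congr fun v => ?_
    rw [enorm_mul, ← ofReal_norm (sympChar _ _), norm_sympChar]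
    simp

/-- The mean square of the shift defect of the window `ψ` at scale `δ`, relative to the reference
window `θ`. -/
def meanShiftDefect (θ ψ : L2) (δ : ℝ) : ℝ≥0∞ :=
  ∫⁻ v, ‖shiftDefect θ ψ (δ • v)‖ₑ ^ 2 ∂phaseGaussMeasure

/-- Moyal's identity, averaged over the shifts. -/
theorem lintegral_lintegral_stft_shiftDefect (δ : ℝ) (θ ψ f : L2) :
    ∫⁻ z, ∫⁻ v, ‖stft (shiftDefect θ ψ (δ • v)) (tfShift (δ • v) f) z‖ₑ ^ 2 ∂phaseGaussMeasure
      = meanShiftDefect θ ψ δ * ‖f‖ₑ ^ 2 := by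
  have hsh : Continuous fun p : Phase × Phase => δ • p.2 := by fun_prop
  have hc : Continuous fun p : Phase × Phase =>
      stft (shiftDefect θ ψ (δ • p.2)) (tfShift (δ • p.2) f) p.1 :=
    continuous_stft_comp ((continuous_shiftDefect θ ψ).comp hsh)
      (continuous_tfShift_comp hsh continuous_const) continuous_fst
  rw [lintegral_lintegral_swap (hc.measurable.enorm.pow_const 2).aemeasurable]
  simp only [lintegral_stft_sq]
  rw [meanShiftDefect, ← lintegral_mul_const' _ _ (by simp)]
  refine lintegral_congr fun v => ?_
  rw [← ofReal_norm (tfShift _ _), norm_tfShift, ofReal_norm]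

theorem tendsto_meanShiftDefect {θ : L2} (hθ : ‖θ‖ = 1) (ψ : L2) :
    Filter.Tendsto (meanShiftDefect θ ψ) (nhds 0) (nhds 0) := by
  have h : Filter.Tendsto (meanShiftDefect θ ψ) (nhds 0)
      (nhds (∫⁻ _, 0 ∂phaseGaussMeasure)) := by
    refine tendsto_lintegral_filter_of_dominated_convergence
      (fun _ => ENNReal.ofReal (2 * ‖ψ‖) ^ 2) ?_ ?_ ?_ ?_
    · refine Filter.Eventually.of_forall fun δ => ?_
      have hc : Continuous fun v : Phase => ‖shiftDefect θ ψ (δ • v)‖ :=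
        ((continuous_shiftDefect θ ψ).comp (by fun_prop)).norm
      simp only [← ofReal_norm]
      exact (hc.measurable.ennreal_ofReal).pow_const 2
    · refine Filter.Eventually.of_forall fun δ => Filter.Eventually.of_forall fun v => ?_
      rw [← ofReal_norm]
      gcongr
      exact norm_shiftDefect_le hθ ψ _
    · rw [lintegral_const, measure_univ, mul_one]
      exact ENNReal.pow_ne_top ENNReal.ofReal_ne_top
    · refine Filter.Eventually.of_forall fun v => ?_
      have hc : Continuous fun δ : ℝ => ‖shiftDefect θ ψ (δ • v)‖ₑ ^ 2 :=
        (ENNReal.continuous_pow 2).comp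
          (continuous_enorm.comp ((continuous_shiftDefect θ ψ).comp (by fun_prop)))
      have := hc.tendsto 0
      simpa only [zero_smul, shiftDefect_zero hθ, enorm_zero, ne_eq, OfNat.ofNat_ne_zero,
        not_false_eq_true, zero_pow] using this
  simpa using h

/-! ### Estimates for a single symbol -/

theorem summable_and_tsum_le_of_ofReal {ι : Type*} {x : ι → ℝ} (hx : ∀ i, 0 ≤ x i) {C : ℝ}
    (hC : 0 ≤ C) (h : ∑' i, ENNReal.ofReal (x i) ≤ ENNReal.ofReal C) :
    Summable x ∧ ∑' i, x i ≤ C := by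
  have hs : Summable x := by
    have := ENNReal.summable_toReal (h.trans_lt ENNReal.ofReal_lt_top).ne
    simpa only [ENNReal.toReal_ofReal (hx _)] using this
  refine ⟨hs, ?_⟩
  rw [← ENNReal.ofReal_tsum_of_nonneg hx hs] at h
  exact (ENNReal.ofReal_le_ofReal_iff hC).1 h

/-- A family of weights with bounded sum, tested against finitely many functions whose choice may
depend on the index of the weight. -/
theorem tsum_lintegral_mul_le {Γ J : Type*} [Countable Γ] [Fintype J] {w : Γ → Phase → ℝ≥0∞}
    (hw : ∀ γ, AEMeasurable (w γ)) {b : ℝ≥0∞} (hb : ∀ z, ∑' γ, w γ z ≤ b)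
    {F : J → Phase → ℝ≥0∞} (hF : ∀ j, AEMeasurable (F j)) (k : Γ → J) :
    ∑' γ, ∫⁻ z, w γ z * F (k γ) z ≤ b * ∑ j, ∫⁻ z, F j z := by
  have e := lintegral_tsum (f := fun γ z => w γ z * F (k γ) z) fun γ => (hw γ).mul (hF (k γ))
  rw [← e,
    ← lintegral_finsetSum' _ fun j _ => hF j,
    ← lintegral_const_mul'' _ (Finset.aemeasurable_fun_sum _ fun j _ => hF j)]
  refine lintegral_mono fun z => ?_
  calc ∑' γ, w γ z * F (k γ) z ≤ ∑' γ, w γ z * ∑ j, F j z := by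
        refine ENNReal.tsum_le_tsum fun γ => ?_
        gcongr
        exact Finset.single_le_sum (f := fun j => F j z) (fun _ _ => zero_le) (Finset.mem_univ _)
    _ = (∑' γ, w γ z) * ∑ j, F j z := ENNReal.tsum_mul_right
    _ ≤ b * ∑ j, F j z := by gcongr; exact hb z

theorem integrable_mul_norm_sq {m : Phase → ℝ} (hm : Integrable m) {u : Phase → ℂ}
    (hu : Continuous u) {C : ℝ} (hC : ∀ z, ‖u z‖ ≤ C) : Integrable fun z => m z * ‖u z‖ ^ 2 := by
  refine hm.mul_bdd (c := C ^ 2) (hu.norm.pow 2).aestronglyMeasurable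
    (Filter.Eventually.of_forall fun z => ?_)
  rw [Real.norm_of_nonneg (by positivity)]
  gcongr
  exact hC z

theorem ofReal_integral_mul_norm_sq {m : Phase → ℝ} (h0 : ∀ z, 0 ≤ m z) {u : Phase → ℂ}
    (hi : Integrable fun z => m z * ‖u z‖ ^ 2) :
    ENNReal.ofReal (∫ z, m z * ‖u z‖ ^ 2) = ∫⁻ z, ENNReal.ofReal (m z) * ‖u z‖ₑ ^ 2 := by
  rw [ofReal_integral_eq_lintegral_ofReal hi
    (Filter.Eventually.of_forall fun z => mul_nonneg (h0 z) (by positivity))]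
  refine lintegral_congr fun z => ?_
  rw [ENNReal.ofReal_mul (h0 z), ENNReal.ofReal_pow (norm_nonneg _), ofReal_norm]

theorem integrable_mul_norm_stft_sq {m : Phase → ℝ} (hm : Integrable m) (φ f : L2) :
    Integrable fun z => m z * ‖stft φ f z‖ ^ 2 :=
  integrable_mul_norm_sq hm (continuous_stft φ f) (norm_stft_le φ f)

/-- A localization operator with bounded symbol and unit window is the composition of the isometry
`f ↦ V_θ f`, the multiplication by the symbol, and the adjoint of that isometry. -/
theorem norm_locOp_sq_le {m : Phase → ℝ} (hm : Integrable m) (hmc : Continuous m)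
    (hm1 : ∀ z, |m z| ≤ 1) {θ : L2} (hθ : ‖θ‖ = 1) (f : L2) :
    ‖locOp m θ f‖ ^ 2 ≤ ∫ z, m z ^ 2 * ‖stft θ f z‖ ^ 2 := by
  set g := locOp m θ f with hg
  have hi : Integrable fun z => m z ^ 2 * ‖stft θ f z‖ ^ 2 := by
    refine (integrable_norm_stft_sq θ f).bdd_mul (c := 1) (hmc.pow 2).aestronglyMeasurable
      (Filter.Eventually.of_forall fun z => ?_)
    rw [norm_pow]
    exact pow_le_one₀ (norm_nonneg _) (hm1 z)
  have h1 : ‖g‖ ^ 2 = ‖∫ z, (m z : ℂ) * (starRingEnd ℂ (stft θ g z) * stft θ f z)‖ := by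
    rw [← inner_locOp hm, ← hg, inner_self_eq_norm_sq_to_K]
    simp
  have h2 : ‖g‖ ^ 2 ≤ ∫ z, (1 / 2 * (m z ^ 2 * ‖stft θ f z‖ ^ 2) + 1 / 2 * ‖stft θ g z‖ ^ 2) := by
    rw [h1]
    refine norm_integral_le_of_norm_le
      ((hi.const_mul _).add ((integrable_norm_stft_sq θ g).const_mul _))
      (Filter.Eventually.of_forall fun z => ?_)
    rw [norm_mul, norm_mul, RCLike.norm_conj, Complex.norm_real, Real.norm_eq_abs, ← sq_abs (m z)]
    nlinarith [sq_nonneg (|m z| * ‖stft θ f z‖ - ‖stft θ g z‖)]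
  rw [integral_add (hi.const_mul _) ((integrable_norm_stft_sq θ g).const_mul _),
    integral_const_mul, integral_const_mul, integral_norm_stft_sq, hθ] at h2
  linarith

/-- The estimate for a single symbol: the quadratic form of `H_{m,ψ}` at `f` is controlled by the
norm of `H_{m,ψ} f`, tested against an arbitrary `g`, by the part of the form cut away by `ω`, and
by the extent to which `g` fails to represent `f` localized by `ω`. -/
theorem quadraticForm_le {m ω : Phase → ℝ} (hm : Integrable m) (hm0 : ∀ z, 0 ≤ m z)
    (hωc : Continuous ω) (hω0 : ∀ z, 0 ≤ ω z) (hω1 : ∀ z, ω z ≤ 1) (ψ f g : L2) {s : ℝ}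
    (hs : 0 < s) :
    1 / 2 * ∫ z, m z * ‖stft ψ f z‖ ^ 2 ≤
      (∫ z, (m z * (1 - ω z)) * ‖stft ψ f z‖ ^ 2)
      + 1 / 2 * (∫ z, m z * ‖(ω z : ℂ) * stft ψ f z - stft ψ g z‖ ^ 2)
      + s / 2 * ‖g‖ ^ 2 + 1 / (2 * s) * ‖locOp m ψ f‖ ^ 2 := by
  set T := locOp m ψ f with hT
  set D : Phase → ℂ := fun z => (ω z : ℂ) * stft ψ f z - stft ψ g z with hD
  have hωb : ∀ z, ‖ω z‖ ≤ 1 := fun z => by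
    rw [Real.norm_of_nonneg (hω0 z)]; exact hω1 z
  have hDc : Continuous D :=
    ((Complex.continuous_ofReal.comp hωc).mul (continuous_stft ψ f)).sub (continuous_stft ψ g)
  have hDb : ∀ z, ‖D z‖ ≤ ‖ψ‖ * ‖f‖ + ‖ψ‖ * ‖g‖ := fun z => by
    refine (norm_sub_le _ _).trans (add_le_add ?_ (norm_stft_le ψ g z))
    rw [norm_mul, Complex.norm_real]
    calc _ ≤ 1 * (‖ψ‖ * ‖f‖) := by
          gcongr
          exacts [hωb z, norm_stft_le ψ f z]
      _ = _ := one_mul _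
  have iQ := integrable_mul_norm_stft_sq hm ψ f
  have iD : Integrable fun z => m z * ‖D z‖ ^ 2 := integrable_mul_norm_sq hm hDc hDb
  have iω : Integrable fun z => m z * ω z * ‖stft ψ f z‖ ^ 2 := by
    refine (iQ.bdd_mul (c := 1) hωc.aestronglyMeasurable
      (Filter.Eventually.of_forall hωb)).congr (Filter.Eventually.of_forall fun z => ?_)
    simp only
    ring
  have iT : Integrable fun z => (m z * (1 - ω z)) * ‖stft ψ f z‖ ^ 2 := by
    refine (iQ.sub iω).congr (Filter.Eventually.of_forall fun z => ?_)
    simp only [Pi.sub_apply]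
    ring
  have split : ∫ z, m z * ‖stft ψ f z‖ ^ 2 = (∫ z, (m z * (1 - ω z)) * ‖stft ψ f z‖ ^ 2)
      + ∫ z, m z * ω z * ‖stft ψ f z‖ ^ 2 := by
    rw [← integral_add iT iω]
    refine integral_congr_ae (Filter.Eventually.of_forall fun z => ?_)
    simp only
    ring
  -- the cut-off form is the pairing of `T` with `g` up to an error governed by `D`
  have iC : Integrable fun z => (m z : ℂ) * (starRingEnd ℂ (D z) * stft ψ f z) := by
    refine hm.ofReal.mul_bdd (c := (‖ψ‖ * ‖f‖ + ‖ψ‖ * ‖g‖) * (‖ψ‖ * ‖f‖))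
      (((Complex.continuous_conj.comp hDc).mul (continuous_stft ψ f)).aestronglyMeasurable)
      (Filter.Eventually.of_forall fun z => ?_)
    rw [norm_mul, RCLike.norm_conj]
    gcongr
    exacts [hDb z, norm_stft_le ψ f z]
  have iG : Integrable fun z => (m z : ℂ) * (starRingEnd ℂ (stft ψ g z) * stft ψ f z) := by
    refine hm.ofReal.mul_bdd (c := (‖ψ‖ * ‖g‖) * (‖ψ‖ * ‖f‖))
      (((Complex.continuous_conj.comp (continuous_stft ψ g)).mul
        (continuous_stft ψ f)).aestronglyMeasurable)
      (Filter.Eventually.of_forall fun z => ?_)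
    rw [norm_mul, RCLike.norm_conj]
    gcongr
    exacts [norm_stft_le ψ g z, norm_stft_le ψ f z]
  have pair : ((∫ z, m z * ω z * ‖stft ψ f z‖ ^ 2 : ℝ) : ℂ)
      = (∫ z, (m z : ℂ) * (starRingEnd ℂ (D z) * stft ψ f z)) + inner ℂ g T := by
    rw [hT, inner_locOp hm, ← integral_add iC iG, ← integral_complex_ofReal]
    refine integral_congr_ae (Filter.Eventually.of_forall fun z => ?_)
    simp only [hD, map_sub, map_mul, Complex.conj_ofReal]
    have := RCLike.conj_mul (stft ψ f z)
    push_cast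
    simp only [Complex.coe_algebraMap] at this
    linear_combination (-(m z : ℂ) * (ω z : ℂ)) * this
  have e1 : ‖∫ z, (m z : ℂ) * (starRingEnd ℂ (D z) * stft ψ f z)‖
      ≤ ∫ z, (1 / 2 * (m z * ‖D z‖ ^ 2) + 1 / 2 * (m z * ‖stft ψ f z‖ ^ 2)) := by
    refine norm_integral_le_of_norm_le ((iD.const_mul _).add (iQ.const_mul _))
      (Filter.Eventually.of_forall fun z => ?_)
    rw [norm_mul, norm_mul, RCLike.norm_conj, Complex.norm_real, Real.norm_of_nonneg (hm0 z)]
    nlinarith [mul_nonneg (hm0 z) (sq_nonneg (‖D z‖ - ‖stft ψ f z‖))]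
  rw [integral_add (iD.const_mul _) (iQ.const_mul _), integral_const_mul, integral_const_mul] at e1
  have e2 : ‖inner ℂ g T‖ ≤ s / 2 * ‖g‖ ^ 2 + 1 / (2 * s) * ‖T‖ ^ 2 := by
    refine (norm_inner_le_norm _ _).trans ?_
    have h : s / 2 * ‖g‖ ^ 2 + 1 / (2 * s) * ‖T‖ ^ 2 - ‖g‖ * ‖T‖
        = 1 / (2 * s) * (s * ‖g‖ - ‖T‖) ^ 2 := by
      field_simp
      ring
    have h2 : 0 ≤ 1 / (2 * s) * (s * ‖g‖ - ‖T‖) ^ 2 := by positivity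
    linarith
  have e3 : ∫ z, m z * ω z * ‖stft ψ f z‖ ^ 2
      ≤ ‖∫ z, (m z : ℂ) * (starRingEnd ℂ (D z) * stft ψ f z)‖ + ‖inner ℂ g T‖ := by
    refine le_trans ?_ (norm_add_le _ _)
    rw [← pair, Complex.norm_real]
    exact le_abs_self _
  linarith

/-! ### The lower bound for selections from finitely many windows -/

theorem SumApproxOne.exists_ofReal {Γ : Set Phase} {η : Γ → Phase → ℝ}
    (h0 : ∀ (γ : Γ) (z : Phase), 0 ≤ η γ z) (h : SumApproxOne η) :
    ∃ A B : ℝ, 0 < A ∧ 0 < B ∧ ∀ z : Phase, ENNReal.ofReal A ≤ ∑' γ : Γ, ENNReal.ofReal (η γ z) ∧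
      ∑' γ : Γ, ENNReal.ofReal (η γ z) ≤ ENNReal.ofReal B := by
  obtain ⟨A, B, hA, hAB, hz⟩ := h
  refine ⟨A, B, hA, hA.trans_le hAB, fun z => ?_⟩
  obtain ⟨hs, h1, h2⟩ := hz z
  rw [← ENNReal.ofReal_tsum_of_nonneg (fun γ => h0 γ z) hs]
  exact ⟨ENNReal.ofReal_le_ofReal h1, ENNReal.ofReal_le_ofReal h2⟩

theorem enorm_sq_eq_ofReal {E : Type*} [SeminormedAddCommGroup E] (x : E) :
    ‖x‖ₑ ^ 2 = ENNReal.ofReal (‖x‖ ^ 2) := by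
  rw [ENNReal.ofReal_pow (norm_nonneg _), ofReal_norm]

/-- Moyal's identity bounds sums of weighted spectrograms with windows from a finite set. -/
theorem tsum_integral_mul_stft_le {Γ J : Type*} [Countable Γ] [Fintype J] {m : Γ → Phase → ℝ}
    (h0 : ∀ γ z, 0 ≤ m γ z) (hm : ∀ γ, AEMeasurable (m γ))
    {b : ℝ} (hb0 : 0 ≤ b) (hb : ∀ z, ∑' γ, ENNReal.ofReal (m γ z) ≤ ENNReal.ofReal b)
    (θ : J → L2) (k : Γ → J) (f : L2)
    (hi : ∀ γ, Integrable fun z => m γ z * ‖stft (θ (k γ)) f z‖ ^ 2) :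
    Summable (fun γ => ∫ z, m γ z * ‖stft (θ (k γ)) f z‖ ^ 2) ∧
      ∑' γ, ∫ z, m γ z * ‖stft (θ (k γ)) f z‖ ^ 2 ≤ b * (∑ j, ‖θ j‖ ^ 2) * ‖f‖ ^ 2 := by
  refine summable_and_tsum_le_of_ofReal
    (fun γ => integral_nonneg fun z => mul_nonneg (h0 γ z) (by positivity)) (by positivity) ?_
  simp only [fun γ => ofReal_integral_mul_norm_sq (h0 γ) (hi γ)]
  refine (tsum_lintegral_mul_le (fun γ => (hm γ).ennreal_ofReal) hb
    (F := fun j z => ‖stft (θ j) f z‖ₑ ^ 2)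
    (fun j => ((continuous_stft _ _).measurable.enorm.pow_const 2).aemeasurable) k).trans_eq ?_
  simp only [lintegral_stft_sq]
  simp only [enorm_sq_eq_ofReal]
  rw [← Finset.sum_mul, ← ENNReal.ofReal_sum_of_nonneg fun j _ => by positivity,
    ← ENNReal.ofReal_mul (by positivity), ← ENNReal.ofReal_mul hb0, mul_assoc]

/-- Windows close to a common unit window give a coercive sum of quadratic forms, whichever window
is selected for which symbol. The reason is the pointwise bound
`|V_{θ₀} f|² ≤ 2 |V_{θ_j} f|² + 2 |V_{θ_j - θ₀} f|²`. -/
theorem le_tsum_integral_mul_stft {Γ J : Type*} [Countable Γ] [Fintype J] {m : Γ → Phase → ℝ}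
    (h0 : ∀ γ z, 0 ≤ m γ z) (hm : ∀ γ, Integrable (m γ)) {A : ℝ} (hA : 0 < A)
    (hb : ∀ z, ENNReal.ofReal A ≤ ∑' γ, ENNReal.ofReal (m γ z))
    (θ : J → L2) {θ₀ : L2} (hθ₀ : ‖θ₀‖ = 1) (k : Γ → J) (f : L2)
    (hs : Summable fun γ => ∫ z, m γ z * ‖stft (θ (k γ)) f z‖ ^ 2) :
    A * (1 / 2 - ∑ j, ‖θ j - θ₀‖ ^ 2) * ‖f‖ ^ 2
      ≤ ∑' γ, ∫ z, m γ z * ‖stft (θ (k γ)) f z‖ ^ 2 := by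
  set X : Phase → ℝ := fun z =>
    1 / 2 * ‖stft θ₀ f z‖ ^ 2 - ∑ j, ‖stft (θ j - θ₀) f z‖ ^ 2 with hX
  have iX : Integrable X :=
    ((integrable_norm_stft_sq θ₀ f).const_mul _).sub
      (integrable_finsetSum _ fun j _ => integrable_norm_stft_sq _ f)
  have intX : ∫ z, X z = (1 / 2 - ∑ j, ‖θ j - θ₀‖ ^ 2) * ‖f‖ ^ 2 := by
    rw [hX, integral_sub ((integrable_norm_stft_sq θ₀ f).const_mul _)
      (integrable_finsetSum _ fun j _ => integrable_norm_stft_sq _ f), integral_const_mul,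
      integral_finsetSum _ fun j _ => integrable_norm_stft_sq _ f]
    simp only [integral_norm_stft_sq, hθ₀, ← Finset.sum_mul]
    ring
  have hXle : ∀ j z, X z ≤ ‖stft (θ j) f z‖ ^ 2 := by
    intro j z
    have h1 : ‖stft (θ j - θ₀) f z‖ ^ 2 ≤ ∑ j, ‖stft (θ j - θ₀) f z‖ ^ 2 :=
      Finset.single_le_sum (f := fun j => ‖stft (θ j - θ₀) f z‖ ^ 2)
        (fun _ _ => by positivity) (Finset.mem_univ j)
    have h2 : ‖stft θ₀ f z‖ ≤ ‖stft (θ j) f z‖ + ‖stft (θ j - θ₀) f z‖ := by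
      have := norm_sub_le (stft (θ j) f z) (stft (θ j - θ₀) f z)
      rwa [stft_sub_left, sub_sub_cancel, ← stft_sub_left] at this
    have h3 : ‖stft θ₀ f z‖ ^ 2 ≤ (‖stft (θ j) f z‖ + ‖stft (θ j - θ₀) f z‖) ^ 2 := by gcongr
    simp only [hX]
    nlinarith [sq_nonneg (‖stft (θ j) f z‖ - ‖stft (θ j - θ₀) f z‖)]
  have hQ0 : ∀ γ, 0 ≤ ∫ z, m γ z * ‖stft (θ (k γ)) f z‖ ^ 2 := fun γ =>
    integral_nonneg fun z => mul_nonneg (h0 γ z) (by positivity)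
  have hQ : ∀ γ, ENNReal.ofReal (∫ z, m γ z * ‖stft (θ (k γ)) f z‖ ^ 2)
      = ∫⁻ z, ENNReal.ofReal (m γ z) * ‖stft (θ (k γ)) f z‖ₑ ^ 2 := fun γ =>
    ofReal_integral_mul_norm_sq (h0 γ) (integrable_mul_norm_stft_sq (hm γ) _ _)
  have key : ENNReal.ofReal (∫ z, A * X z)
      ≤ ENNReal.ofReal (∑' γ, ∫ z, m γ z * ‖stft (θ (k γ)) f z‖ ^ 2) := by
    rw [ENNReal.ofReal_tsum_of_nonneg hQ0 hs]
    simp only [hQ]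
    have e := lintegral_tsum (μ := volume)
      (f := fun γ z => ENNReal.ofReal (m γ z) * ‖stft (θ (k γ)) f z‖ₑ ^ 2)
      fun γ => ((hm γ).1.aemeasurable.ennreal_ofReal).mul
        ((continuous_stft _ _).measurable.enorm.pow_const 2).aemeasurable
    rw [← e]
    calc ENNReal.ofReal (∫ z, A * X z) ≤ ∫⁻ z, ENNReal.ofReal (A * X z) := by
          have h1 : ∫ z, A * X z ≤ ∫ z, max (A * X z) 0 :=
            integral_mono (iX.const_mul A) (iX.const_mul A).pos_part fun z => le_max_left _ _
          refine (ENNReal.ofReal_le_ofReal h1).trans_eq ?_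
          rw [ofReal_integral_eq_lintegral_ofReal (iX.const_mul A).pos_part
            (Filter.Eventually.of_forall fun z => le_max_right _ _)]
          refine lintegral_congr fun z => ?_
          rw [ENNReal.ofReal_max, ENNReal.ofReal_zero, max_eq_left zero_le]
      _ ≤ ∫⁻ z, ∑' γ, ENNReal.ofReal (m γ z) * ‖stft (θ (k γ)) f z‖ₑ ^ 2 := by
          refine lintegral_mono fun z => ?_
          rw [ENNReal.ofReal_mul hA.le]
          calc _ ≤ (∑' γ, ENNReal.ofReal (m γ z)) * ENNReal.ofReal (X z) := by
                gcongr
                exact hb z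
            _ = ∑' γ, ENNReal.ofReal (m γ z) * ENNReal.ofReal (X z) :=
                ENNReal.tsum_mul_right.symm
            _ ≤ _ := by
                refine ENNReal.tsum_le_tsum fun γ => ?_
                rw [enorm_sq_eq_ofReal]
                gcongr
                exact hXle _ z
  rw [ENNReal.ofReal_le_ofReal_iff (tsum_nonneg hQ0), integral_const_mul, intX] at key
  rw [mul_assoc]
  exact key

/-- The total error made when localizing the short-time Fourier transforms of `f` by Gaussian
cut-offs is replaced by localizing `f`. -/
theorem tsum_defect_le {Γ : Set Phase} [Countable Γ] {J : Type*} [Fintype J] {m : Γ → Phase → ℝ}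
    (h0 : ∀ γ z, 0 ≤ m γ z) (hm : ∀ γ, Integrable (m γ)) {B : ℝ} (hB : 0 ≤ B)
    (hb : ∀ z, ∑' γ, ENNReal.ofReal (m γ z) ≤ ENNReal.ofReal B)
    (θ : J → L2) (θ₀ : L2) (k : Γ → J) {δ ρ : ℝ} (hδ : 0 < δ) (hρ : 0 ≤ ρ)
    (hdef : ∑ j, meanShiftDefect θ₀ (θ j) δ ≤ ENNReal.ofReal ρ) (f : L2) :
    Summable (fun γ : Γ => ∫ z, m γ z * ‖(phaseGauss δ (z - γ) : ℂ) * stft (θ (k γ)) f z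
        - stft (θ (k γ)) (locOp (fun z => phaseGauss δ (z - γ)) θ₀ f) z‖ ^ 2) ∧
      ∑' γ : Γ, ∫ z, m γ z * ‖(phaseGauss δ (z - γ) : ℂ) * stft (θ (k γ)) f z
        - stft (θ (k γ)) (locOp (fun z => phaseGauss δ (z - γ)) θ₀ f) z‖ ^ 2
        ≤ B * ρ * ‖f‖ ^ 2 := by
  set D : Γ → Phase → ℂ := fun γ z => (phaseGauss δ (z - γ) : ℂ) * stft (θ (k γ)) f z
        - stft (θ (k γ)) (locOp (fun z => phaseGauss δ (z - γ)) θ₀ f) z with hD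
  have hDc : ∀ γ, Continuous (D γ) := fun γ =>
    ((Complex.continuous_ofReal.comp ((continuous_phaseGauss δ).comp (continuous_sub_right _))).mul
      (continuous_stft _ f)).sub (continuous_stft _ _)
  have hDb : ∀ γ z, ‖D γ z‖ ≤ ‖θ (k γ)‖ * ‖f‖
      + ‖θ (k γ)‖ * ‖locOp (fun z => phaseGauss δ (z - γ)) θ₀ f‖ := fun γ z => by
    refine (norm_sub_le _ _).trans (add_le_add ?_ (norm_stft_le _ _ z))
    rw [norm_mul, Complex.norm_real, Real.norm_of_nonneg (phaseGauss_pos _ _).le]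
    calc _ ≤ 1 * (‖θ (k γ)‖ * ‖f‖) := by
          gcongr
          exacts [phaseGauss_le_one _ _, norm_stft_le _ f z]
      _ = _ := one_mul _
  refine summable_and_tsum_le_of_ofReal
    (fun γ => integral_nonneg fun z => mul_nonneg (h0 γ z) (by positivity)) (by positivity) ?_
  have e1 : ∀ γ, ENNReal.ofReal (∫ z, m γ z * ‖D γ z‖ ^ 2)
      = ∫⁻ z, ENNReal.ofReal (m γ z) * ‖D γ z‖ₑ ^ 2 := fun γ =>
    ofReal_integral_mul_norm_sq (h0 γ) (integrable_mul_norm_sq (hm γ) (hDc γ) (hDb γ))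
  have hsh : Continuous fun p : Phase × Phase => δ • p.2 := by fun_prop
  have hF : ∀ j, Measurable fun z => ∫⁻ v, ‖stft (shiftDefect θ₀ (θ j) (δ • v))
      (tfShift (δ • v) f) z‖ₑ ^ 2 ∂phaseGaussMeasure := fun j => by
    have hc : Continuous fun p : Phase × Phase =>
        stft (shiftDefect θ₀ (θ j) (δ • p.2)) (tfShift (δ • p.2) f) p.1 :=
      continuous_stft_comp ((continuous_shiftDefect θ₀ (θ j)).comp hsh)
        (continuous_tfShift_comp hsh continuous_const) continuous_fst
    exact (hc.measurable.enorm.pow_const 2).lintegral_prod_right'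
  calc ∑' γ, ENNReal.ofReal (∫ z, m γ z * ‖D γ z‖ ^ 2)
      = ∑' γ, ∫⁻ z, ENNReal.ofReal (m γ z) * ‖D γ z‖ₑ ^ 2 := by simp only [e1]
    _ ≤ ∑' γ, ∫⁻ z, ENNReal.ofReal (m γ z) * ∫⁻ v, ‖stft (shiftDefect θ₀ (θ (k γ)) (δ • v))
          (tfShift (δ • v) f) z‖ₑ ^ 2 ∂phaseGaussMeasure := by
        refine ENNReal.tsum_le_tsum fun γ => lintegral_mono fun z => ?_
        gcongr
        exact enorm_phaseGauss_mul_stft_sub_sq_le hδ _ _ _ _ _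
    _ ≤ ENNReal.ofReal B * ∑ j, ∫⁻ z, ∫⁻ v, ‖stft (shiftDefect θ₀ (θ j) (δ • v))
          (tfShift (δ • v) f) z‖ₑ ^ 2 ∂phaseGaussMeasure :=
        tsum_lintegral_mul_le (fun γ => (hm γ).1.aemeasurable.ennreal_ofReal) hb
          (F := fun j z => ∫⁻ v, ‖stft (shiftDefect θ₀ (θ j) (δ • v))
            (tfShift (δ • v) f) z‖ₑ ^ 2 ∂phaseGaussMeasure) (fun j => (hF j).aemeasurable) k
    _ = ENNReal.ofReal B * ((∑ j, meanShiftDefect θ₀ (θ j) δ) * ‖f‖ₑ ^ 2) := by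
        simp only [lintegral_lintegral_stft_shiftDefect, ← Finset.sum_mul]
    _ ≤ ENNReal.ofReal B * (ENNReal.ofReal ρ * ‖f‖ₑ ^ 2) := by gcongr
    _ = ENNReal.ofReal (B * ρ * ‖f‖ ^ 2) := by
        rw [enorm_sq_eq_ofReal, ← ENNReal.ofReal_mul hρ, ← ENNReal.ofReal_mul hB, mul_assoc]

theorem re_inner_locOpL {m : Phase → ℝ} (hm : Integrable m) (φ f : L2) :
    (inner ℂ f (locOpL m φ f)).re = ∫ z, m z * ‖stft φ f z‖ ^ 2 := by
  rw [locOpL_apply hm, inner_locOp_self hm, Complex.ofReal_re]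

set_option maxHeartbeats 400000 in
/-- The lower bound `c ‖f‖² ≤ ∑_γ ‖H_γ f‖²` for localization operators whose windows are selected
from a finite set close to a common unit window. The constant does not depend on the selection. -/
theorem exists_le_tsum_norm_locOp_sq {Γ : Set Phase} {η : Γ → Phase → ℝ} (hη : WellSpread Γ η)
    (h0 : ∀ (γ : Γ) (z : Phase), 0 ≤ η γ z) (hsum : SumApproxOne η) {J : Type*} [Fintype J]
    (θ : J → L2) {θ₀ : L2} (hθ₀ : ‖θ₀‖ = 1) (hclose : ∑ j, ‖θ j - θ₀‖ ^ 2 < 1 / 2) :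
    ∃ c K : ℝ, 0 < c ∧ 0 < K ∧ ∀ (k : Γ → J) (f : L2),
      (Summable fun γ => ∫ z, η γ z * ‖stft (θ (k γ)) f z‖ ^ 2) ∧
      ∑' γ, ∫ z, η γ z * ‖stft (θ (k γ)) f z‖ ^ 2 ≤ K * ‖f‖ ^ 2 ∧
      (Summable fun γ => ‖locOp (η γ) (θ (k γ)) f‖ ^ 2) ∧
      c * ‖f‖ ^ 2 ≤ ∑' γ, ‖locOp (η γ) (θ (k γ)) f‖ ^ 2 := by
  have := hη.separated.countable
  obtain ⟨A, B, hA, hB, hAB⟩ := hsum.exists_ofReal h0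
  have hint := hη.integrable
  obtain ⟨L, hL⟩ : ∃ L : ℝ, L = ∑ j, ‖θ j‖ ^ 2 := ⟨_, rfl⟩
  have hL0 : 0 ≤ L := hL ▸ Finset.sum_nonneg fun _ _ => by positivity
  obtain ⟨τ, hτ⟩ : ∃ τ : ℝ, τ = A * (1 / 2 - ∑ j, ‖θ j - θ₀‖ ^ 2) := ⟨_, rfl⟩
  have hτ0 : 0 < τ := hτ ▸ mul_pos hA (by linarith)
  -- choose the width `1 / δ` of the cut-off such that its costs, bounded in terms of `κ` and `ρ`,
  -- stay below the coercivity constant `τ` of the quadratic forms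
  have hlim : Filter.Tendsto (fun δ => ∑ j, meanShiftDefect θ₀ (θ j) δ)
      (nhdsWithin 0 (Set.Ioi 0)) (nhds 0) := by
    have := tendsto_finsetSum Finset.univ fun j (_ : j ∈ Finset.univ) =>
      (tendsto_meanShiftDefect hθ₀ (θ j)).mono_left
        (nhdsWithin_le_nhds : nhdsWithin (0 : ℝ) (Set.Ioi 0) ≤ nhds 0)
    simpa only [Finset.sum_const_zero] using this
  obtain ⟨ρ, hρ⟩ : ∃ ρ : ℝ, ρ = τ / (8 * B) := ⟨_, rfl⟩
  have hρ0 : 0 < ρ := hρ ▸ div_pos hτ0 (by linarith)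
  obtain ⟨κ, hκ⟩ : ∃ κ : ℝ, κ = τ / (16 * (L + 1)) := ⟨_, rfl⟩
  have hκ0 : 0 < κ := hκ ▸ div_pos hτ0 (by linarith)
  have hev : ∀ᶠ δ in nhdsWithin (0 : ℝ) (Set.Ioi 0), 0 < δ ∧
      ∑ j, meanShiftDefect θ₀ (θ j) δ ≤ ENNReal.ofReal ρ ∧ ∀ z : Phase,
      ∑' γ : Γ, ENNReal.ofReal (η γ z * (1 - phaseGauss δ (z - γ))) ≤ ENNReal.ofReal κ := by
    filter_upwards [self_mem_nhdsWithin, hη.eventually_tail_le hκ0,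
      hlim.eventually_le_const (ENNReal.ofReal_pos.2 hρ0)] with δ h1 h2 h3
    exact ⟨h1, h3, h2⟩
  obtain ⟨δ, hδ, hdef, htail⟩ := hev.exists
  obtain ⟨M, hM0, hM⟩ := hη.separated.tsum_phaseGauss_le hδ
  obtain ⟨s, hs⟩ : ∃ s : ℝ, s = τ / (4 * (M + 1)) := ⟨_, rfl⟩
  have hs0 : 0 < s := hs ▸ div_pos hτ0 (by linarith)
  refine ⟨2 * s * (τ / 4), B * L + 1, by positivity, by positivity, fun k f => ?_⟩
  -- the quadratic forms `∫ η_γ |V f|²` and their coercivity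
  obtain ⟨sQ, uQ⟩ := tsum_integral_mul_stft_le h0 (fun γ => (hint γ).1.aemeasurable) hB.le
    (fun z => (hAB z).2) θ k f fun γ => integrable_mul_norm_stft_sq (hint γ) _ _
  have lQ := le_tsum_integral_mul_stft h0 hint hA (fun z => (hAB z).1) θ hθ₀ k f sQ
  rw [← hL] at uQ
  rw [← hτ] at lQ
  have hQ0 : ∀ γ, 0 ≤ ∫ z, η γ z * ‖stft (θ (k γ)) f z‖ ^ 2 := fun γ =>
    integral_nonneg fun z => mul_nonneg (h0 γ z) (by positivity)
  have hform : ∀ γ (g : L2), ∫ z, η γ z * ‖stft (θ (k γ)) g z‖ ^ 2 ≤ (B * L + 1) * ‖g‖ ^ 2 := by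
    intro γ g
    obtain ⟨sg, ug⟩ := tsum_integral_mul_stft_le h0 (fun γ => (hint γ).1.aemeasurable) hB.le
      (fun z => (hAB z).2) θ k g fun γ => integrable_mul_norm_stft_sq (hint γ) _ _
    rw [← hL] at ug
    have := sg.le_tsum γ fun γ' _ =>
      integral_nonneg fun z => mul_nonneg (h0 γ' z) (by positivity)
    nlinarith [sq_nonneg ‖g‖]
  have sT : Summable fun γ => ‖locOp (η γ) (θ (k γ)) f‖ ^ 2 := by
    refine Summable.of_nonneg_of_le (fun γ => by positivity) (fun γ => ?_)
      (sQ.mul_left (B * L + 1))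
    have := norm_sq_le_mul_re_inner (isSymmetric_locOpL (hint γ) (θ (k γ)))
      (fun x => by
        rw [re_inner_locOpL (hint γ)]
        exact integral_nonneg fun z => mul_nonneg (h0 γ z) (by positivity))
      (M := B * L + 1) (by positivity)
      (fun x => by rw [re_inner_locOpL (hint γ)]; exact hform γ x) f
    rwa [re_inner_locOpL (hint γ), locOpL_apply (hint γ)] at this
  refine ⟨sQ, uQ.trans (by nlinarith [sq_nonneg ‖f‖]), sT, ?_⟩
  -- the localized functions `g_γ`
  have hpg : ∀ γ : Γ, Continuous fun z : Phase => phaseGauss δ (z - γ) := fun γ =>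
    (continuous_phaseGauss δ).comp (continuous_sub_right _)
  have hpi : ∀ γ : Γ, Integrable fun z : Phase => phaseGauss δ (z - γ) := fun γ =>
    (integrable_phaseGauss hδ).comp_sub_right _
  set g : Γ → L2 := fun γ => locOp (fun z => phaseGauss δ (z - γ)) θ₀ f with hg
  have hsqi : ∀ γ : Γ, Integrable fun z : Phase => phaseGauss δ (z - γ) ^ 2 := fun γ => by
    simp only [sq]
    refine (hpi γ).bdd_mul (c := 1) (hpg γ).aestronglyMeasurable
      (Filter.Eventually.of_forall fun z => ?_)
    rw [Real.norm_of_nonneg (phaseGauss_pos _ _).le]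
    exact phaseGauss_le_one _ _
  obtain ⟨sg', ug'⟩ := tsum_integral_mul_stft_le (Γ := Γ) (J := Unit)
    (m := fun γ z => phaseGauss δ (z - γ) ^ 2) (fun _ _ => by positivity)
    (fun γ => (hsqi γ).1.aemeasurable) hM0 hM (fun _ => θ₀) (fun _ => ()) f
    fun γ => integrable_mul_norm_stft_sq (hsqi γ) _ _
  have hgle : ∀ γ, ‖g γ‖ ^ 2 ≤ ∫ z, phaseGauss δ (z - γ) ^ 2 * ‖stft θ₀ f z‖ ^ 2 := fun γ =>
    norm_locOp_sq_le (hpi γ) (hpg γ)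
      (fun z => by rw [abs_of_pos (phaseGauss_pos _ _)]; exact phaseGauss_le_one _ _) hθ₀ f
  have sg : Summable fun γ => ‖g γ‖ ^ 2 :=
    Summable.of_nonneg_of_le (fun γ => by positivity) hgle sg'
  have ug : ∑' γ, ‖g γ‖ ^ 2 ≤ M * ‖f‖ ^ 2 := by
    refine (sg.tsum_le_tsum hgle sg').trans (ug'.trans_eq ?_)
    simp [hθ₀]
  -- the mass of the symbols cut away
  have hti : ∀ γ : Γ, Integrable fun z : Phase => η γ z * (1 - phaseGauss δ (z - γ)) := fun γ => by
    refine (hint γ).mul_bdd (c := 1) (continuous_const.sub (hpg γ)).aestronglyMeasurable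
      (Filter.Eventually.of_forall fun z => ?_)
    have h1 := phaseGauss_le_one δ (z - γ)
    have h2 := phaseGauss_pos δ (z - γ)
    rw [Real.norm_of_nonneg (by linarith)]
    linarith
  obtain ⟨st, ut⟩ := tsum_integral_mul_stft_le (Γ := Γ)
    (m := fun γ z => η γ z * (1 - phaseGauss δ (z - γ)))
    (fun γ z => mul_nonneg (h0 γ z) (by linarith [phaseGauss_le_one δ (z - γ)]))
    (fun γ => (hti γ).1.aemeasurable) hκ0.le htail θ k f
    fun γ => integrable_mul_norm_stft_sq (hti γ) _ _
  rw [← hL] at ut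
  obtain ⟨sR, uR⟩ := tsum_defect_le h0 hint hB.le (fun z => (hAB z).2) θ θ₀ k hδ hρ0.le hdef f
  -- sum up the estimates for the single symbols: of the form `1/2 ∑ ∫ η_γ |V f|² ≥ τ/2 ‖f‖²`, the
  -- costs absorb at most `τ/16 + τ/16 + τ/8`, which leaves `τ/4`
  have hsingle := fun γ : Γ => quadraticForm_le (hint γ) (h0 γ) (hpg γ)
    (fun z => (phaseGauss_pos _ _).le) (fun z => phaseGauss_le_one _ _) (θ (k γ)) f (g γ) hs0
  have hall := Summable.tsum_le_tsum hsingle (sQ.mul_left _)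
    (((st.add (sR.mul_left _)).add (sg.mul_left _)).add (sT.mul_left _))
  rw [Summable.tsum_add ((st.add (sR.mul_left _)).add (sg.mul_left _)) (sT.mul_left _),
    Summable.tsum_add (st.add (sR.mul_left _)) (sg.mul_left _),
    Summable.tsum_add st (sR.mul_left _), tsum_mul_left, tsum_mul_left, tsum_mul_left,
    tsum_mul_left] at hall
  have hf := sq_nonneg ‖f‖
  have b1 : κ * L * ‖f‖ ^ 2 ≤ τ / 16 * ‖f‖ ^ 2 := by
    gcongr
    rw [hκ, div_mul_eq_mul_div, div_le_div_iff₀ (by positivity) (by positivity)]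
    nlinarith
  have b2 : B * ρ * ‖f‖ ^ 2 = τ / 8 * ‖f‖ ^ 2 := by
    rw [hρ]
    field_simp
  have b3 : s / 2 * (M * ‖f‖ ^ 2) ≤ τ / 8 * ‖f‖ ^ 2 := by
    have : s * M ≤ τ / 4 := by
      rw [hs, div_mul_eq_mul_div, div_le_div_iff₀ (by positivity) (by positivity)]
      nlinarith
    nlinarith
  have b4 : s / 2 * ∑' γ, ‖g γ‖ ^ 2 ≤ s / 2 * (M * ‖f‖ ^ 2) := by gcongr
  have b5 : τ / 4 * ‖f‖ ^ 2 ≤ 1 / (2 * s) * ∑' γ, ‖locOp (η γ) (θ (k γ)) f‖ ^ 2 := by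
    linarith
  calc 2 * s * (τ / 4) * ‖f‖ ^ 2 = 2 * s * (τ / 4 * ‖f‖ ^ 2) := by ring
    _ ≤ 2 * s * (1 / (2 * s) * ∑' γ, ‖locOp (η γ) (θ (k γ)) f‖ ^ 2) := by gcongr
    _ = _ := by field_simp

/-! ### The Bargmann transform and the phase-space condition -/

/-- The **Bargmann transform** `ζ ↦ 2^{1/4} ∫ f(t) e^{2πtζ - πt²} dt`, in the normalization without
the factor `e^{-πζ²/2}`. -/
def bargmann (f : L2) (ζ : ℂ) : ℂ :=
  ∫ t : ℝ,
    ((2 : ℝ) ^ (1 / 4 : ℝ) : ℝ) * Complex.exp (-Real.pi * t ^ 2 + 2 * Real.pi * t * ζ) * f t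

/-- The Bargmann transform is the short-time Fourier transform with Gaussian window, up to an
explicit factor and the identification of `(x, ω)` with `x - iω`. -/
theorem stft_gauss_eq_bargmann (f : L2) (z : Phase) :
    stft gauss f z = Complex.exp (-Real.pi * z.1 ^ 2) * bargmann f (z.1 - z.2 * Complex.I) := by
  rw [stft_eq_integral, bargmann, ← integral_const_mul]
  have hg : (fun t : ℝ => gauss (t - z.1)) =ᵐ[volume] fun t : ℝ =>
      (((2 : ℝ) ^ (1 / 4 : ℝ) * Real.exp (-Real.pi * (t - z.1) ^ 2) : ℝ) : ℂ) :=
    (measurePreserving_sub_right volume z.1).quasiMeasurePreserving.ae_eq_comp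
      memLp_gauss.coeFn_toLp
  refine integral_congr_ae ?_
  filter_upwards [hg] with t ht
  rw [ht, map_mul, Complex.conj_ofReal, ← Complex.exp_conj, ← mul_assoc]
  congr 1
  simp only [map_mul, Complex.conj_ofReal, Complex.conj_I, map_ofNat]
  rw [Complex.ofReal_mul, Complex.ofReal_exp, mul_left_comm, mul_left_comm (Complex.exp _)]
  congr 1
  rw [← Complex.exp_add, ← Complex.exp_add]
  congr 1
  push_cast
  ring

theorem integrable_exp_neg_two_mul_sq_mul (f : L2) :
    Integrable fun t : ℝ => Real.exp (-2 * t ^ 2) * ‖f t‖ := by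
  have h : MemLp (fun t : ℝ => Real.exp (-2 * t ^ 2)) 2 (volume : Measure ℝ) := by
    have hc : Continuous fun t : ℝ => Real.exp (-2 * t ^ 2) := by fun_prop
    refine (memLp_two_iff_integrable_sq hc.aestronglyMeasurable).2 ?_
    refine (integrable_exp_neg_mul_sq (b := 4) (by norm_num)).congr
      (Filter.Eventually.of_forall fun t => ?_)
    simp only [← Real.exp_nat_mul]
    congr 1
    push_cast
    ring
  exact h.integrable_mul (Lp.memLp f).norm

/-- The Gaussian factor dominates the exponential of a linear function, locally uniformly in `ζ`.
The factor `e^{|t|}` makes room for the derivative in `ζ`, and `2 < π` for completing the square. -/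
theorem norm_exp_bargmann_le {ζ : ℂ} {R : ℝ} (hζ : ‖ζ‖ ≤ R) (t : ℝ) :
    ‖Complex.exp (-Real.pi * t ^ 2 + 2 * Real.pi * t * ζ)‖ * Real.exp |t|
      ≤ Real.exp ((2 * Real.pi * R + 1) ^ 2) * Real.exp (-2 * t ^ 2) := by
  have e : ((-Real.pi : ℂ) * t ^ 2 + 2 * Real.pi * t * ζ).re
      = -Real.pi * t ^ 2 + 2 * Real.pi * (t * ζ.re) := by
    have : ((-Real.pi : ℂ) * t ^ 2 + 2 * Real.pi * t * ζ)
      = ((-Real.pi * t ^ 2 : ℝ) : ℂ) + ((2 * Real.pi * t : ℝ) : ℂ) * ζ := by push_cast; ring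
    rw [this, Complex.add_re, Complex.ofReal_re, Complex.re_ofReal_mul]
    ring
  rw [Complex.norm_exp, e, ← Real.exp_add, ← Real.exp_add, Real.exp_le_exp]
  have h1 : t * ζ.re ≤ |t| * R := (le_abs_self _).trans <| by
    rw [abs_mul]
    gcongr
    exact (Complex.abs_re_le_norm ζ).trans hζ
  have h2 := mul_le_mul_of_nonneg_left h1 (by positivity : 0 ≤ 2 * Real.pi)
  have h3 := Real.pi_gt_three
  have h4 : t ^ 2 = |t| ^ 2 := (sq_abs t).symm
  rw [h4]
  nlinarith [sq_nonneg (|t| / 2 - (2 * Real.pi * R + 1)), sq_nonneg |t|]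

theorem differentiable_bargmann (f : L2) : Differentiable ℂ (bargmann f) := by
  intro ζ₀
  set a : ℝ := (2 : ℝ) ^ (1 / 4 : ℝ) with ha
  have ha0 : 0 ≤ a := by positivity
  set R := ‖ζ₀‖ + 1
  have hR : ∀ ζ ∈ Metric.ball ζ₀ 1, ‖ζ‖ ≤ R := fun ζ hζ => by
    have := norm_sub_norm_le ζ ζ₀
    rw [mem_ball_iff_norm] at hζ
    simp only [R]
    linarith
  have hmeas : ∀ ζ : ℂ, AEStronglyMeasurable (fun t : ℝ =>
      (a : ℂ) * Complex.exp (-Real.pi * t ^ 2 + 2 * Real.pi * t * ζ) * f t) volume := fun ζ => by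
    have hc : Continuous fun t : ℝ =>
      (a : ℂ) * Complex.exp (-Real.pi * t ^ 2 + 2 * Real.pi * t * ζ) := by fun_prop
    exact hc.aestronglyMeasurable.mul (Lp.aestronglyMeasurable f)
  have hmeas' : AEStronglyMeasurable (fun t : ℝ =>
      (a : ℂ) * (Complex.exp (-Real.pi * t ^ 2 + 2 * Real.pi * t * ζ₀) * (2 * Real.pi * t)) * f t)
      volume := by
    have hc : Continuous fun t : ℝ =>
      (a : ℂ) * (Complex.exp (-Real.pi * t ^ 2 + 2 * Real.pi * t * ζ₀) * (2 * Real.pi * t)) := by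
      fun_prop
    exact hc.aestronglyMeasurable.mul (Lp.aestronglyMeasurable f)
  refine (hasDerivAt_integral_of_dominated_loc_of_deriv_le
    (F' := fun ζ t => (a : ℂ) * (Complex.exp (-Real.pi * t ^ 2 + 2 * Real.pi * t * ζ)
      * (2 * Real.pi * t)) * f t)
    (bound := fun t => a * (2 * Real.pi) * Real.exp ((2 * Real.pi * R + 1) ^ 2)
      * (Real.exp (-2 * t ^ 2) * ‖f t‖))
    (Metric.ball_mem_nhds ζ₀ one_pos) (Filter.Eventually.of_forall hmeas) ?_ hmeas'
    (Filter.Eventually.of_forall fun t ζ hζ => ?_)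
    ((integrable_exp_neg_two_mul_sq_mul f).const_mul _)
    (Filter.Eventually.of_forall fun t ζ _ => ?_)).2.differentiableAt
  · refine ((integrable_exp_neg_two_mul_sq_mul f).const_mul
      (a * Real.exp ((2 * Real.pi * R + 1) ^ 2))).mono' (hmeas ζ₀)
      (Filter.Eventually.of_forall fun t => ?_)
    have h := norm_exp_bargmann_le (hR ζ₀ (Metric.mem_ball_self one_pos)) t
    have h1 : (1 : ℝ) ≤ Real.exp |t| := Real.one_le_exp (abs_nonneg t)
    rw [norm_mul, norm_mul, Complex.norm_real, Real.norm_of_nonneg ha0, ← mul_assoc,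
      mul_assoc a (Real.exp _)]
    gcongr
    exact (le_mul_of_one_le_right (norm_nonneg _) h1).trans h
  · have h := norm_exp_bargmann_le (hR ζ hζ) t
    have h1 : |t| ≤ Real.exp |t| := by linarith [Real.add_one_le_exp |t|]
    have h2 : ‖(2 * Real.pi * t : ℂ)‖ = 2 * Real.pi * |t| := by
      have : (2 * Real.pi * t : ℂ) = ((2 * Real.pi * t : ℝ) : ℂ) := by push_cast; ring
      rw [this, Complex.norm_real, norm_mul, Real.norm_of_nonneg (by positivity), Real.norm_eq_abs]
    rw [norm_mul, norm_mul, norm_mul, h2, Complex.norm_real, Real.norm_of_nonneg ha0]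
    calc _ ≤ a * (‖Complex.exp (-Real.pi * t ^ 2 + 2 * Real.pi * t * ζ)‖
            * (2 * Real.pi * Real.exp |t|)) * ‖f t‖ := by gcongr
      _ = a * (2 * Real.pi) * (‖Complex.exp (-Real.pi * t ^ 2 + 2 * Real.pi * t * ζ)‖
            * Real.exp |t|) * ‖f t‖ := by ring
      _ ≤ a * (2 * Real.pi) * (Real.exp ((2 * Real.pi * R + 1) ^ 2)
            * Real.exp (-2 * t ^ 2)) * ‖f t‖ := by gcongr
      _ = _ := by ring
  · have h1 : HasDerivAt (fun ζ : ℂ => (-Real.pi * t ^ 2 + 2 * Real.pi * t * ζ : ℂ))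
        (2 * Real.pi * t : ℂ) ζ := by
      simpa using ((hasDerivAt_id ζ).const_mul (2 * Real.pi * t : ℂ)).const_add
        (-Real.pi * t ^ 2 : ℂ)
    exact (h1.cexp.const_mul (a : ℂ)).mul_const (f t)

theorem bargmann_gauss (ζ : ℂ) : bargmann gauss ζ = Complex.exp (Real.pi / 2 * ζ ^ 2) := by
  have hre : ((-2 * Real.pi : ℝ) : ℂ).re < 0 := by
    rw [Complex.ofReal_re]
    linarith [Real.pi_pos]
  have hpi : (Real.pi : ℂ) ≠ 0 := by exact_mod_cast Real.pi_ne_zero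
  have e : bargmann gauss ζ = ((Real.sqrt 2 : ℝ) : ℂ) *
      ∫ t : ℝ, Complex.exp (((-2 * Real.pi : ℝ) : ℂ) * t ^ 2 + 2 * Real.pi * ζ * t + 0) := by
    rw [bargmann, ← integral_const_mul]
    refine integral_congr_ae ?_
    filter_upwards [memLp_gauss.coeFn_toLp] with t ht
    have hs : (2 : ℝ) ^ (1 / 4 : ℝ) * (2 : ℝ) ^ (1 / 4 : ℝ) = Real.sqrt 2 := by
      rw [← Real.rpow_add (by norm_num), Real.sqrt_eq_rpow]
      norm_num
    rw [gauss, ht, ← hs, Complex.ofReal_mul, Complex.ofReal_mul, Complex.ofReal_exp,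
      mul_mul_mul_comm, ← Complex.exp_add]
    congr 2
    push_cast
    ring
  rw [e, integral_cexp_quadratic hre]
  have h2 : (Real.pi / -((-2 * Real.pi : ℝ) : ℂ)) = ((1 / 2 : ℝ) : ℂ) := by
    push_cast
    field_simp
  have h3 : (0 : ℂ) - (2 * Real.pi * ζ) ^ 2 / (4 * ((-2 * Real.pi : ℝ) : ℂ))
      = Real.pi / 2 * ζ ^ 2 := by
    push_cast
    field_simp
    ring
  have h4 : (((1 / 2 : ℝ) : ℂ)) ^ (1 / 2 : ℂ) = ((Real.sqrt (1 / 2) : ℝ) : ℂ) := by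
    rw [Real.sqrt_eq_rpow, Complex.ofReal_cpow (by norm_num)]
    norm_num
  rw [h2, h3, h4, ← mul_assoc, ← Complex.ofReal_mul, ← Real.sqrt_mul (by norm_num)]
  norm_num

theorem norm_stft_gauss_gauss (z : Phase) :
    ‖stft gauss gauss z‖ = Real.exp (-(Real.pi / 2) * z.1 ^ 2) *
      Real.exp (-(Real.pi / 2) * z.2 ^ 2) := by
  rw [stft_gauss_eq_bargmann, bargmann_gauss, ← Complex.exp_add, Complex.norm_exp, ← Real.exp_add]
  congr 1
  have : (-Real.pi * z.1 ^ 2 + Real.pi / 2 * (z.1 - z.2 * Complex.I) ^ 2 : ℂ)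
      = ((-(Real.pi / 2) * z.1 ^ 2 + -(Real.pi / 2) * z.2 ^ 2 : ℝ) : ℂ)
        + ((-(Real.pi * z.1 * z.2) : ℝ) : ℂ) * Complex.I := by
    push_cast
    linear_combination (Real.pi / 2 * z.2 ^ 2 : ℂ) * Complex.I_sq
  rw [this, Complex.add_re, Complex.ofReal_re, Complex.re_ofReal_mul, Complex.I_re, mul_zero,
    add_zero]

theorem integral_norm_stft_gauss_gauss : ∫ z : Phase, ‖stft gauss gauss z‖ = 2 := by
  simp only [norm_stft_gauss_gauss]
  rw [Measure.volume_eq_prod, integral_prod_mul (fun x : ℝ => Real.exp (-(Real.pi / 2) * x ^ 2))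
    (fun x : ℝ => Real.exp (-(Real.pi / 2) * x ^ 2)), integral_gaussian,
    Real.mul_self_sqrt (by positivity)]
  field_simp

theorem norm_gauss : ‖gauss‖ = 1 := by
  have h := norm_stft_gauss_gauss 0
  have h0 : tfShift 0 gauss = gauss := tfShift_zero gauss
  rw [stft, h0, inner_self_eq_norm_sq_to_K] at h
  have h1 : ‖gauss‖ ^ 2 = 1 := by simpa using h
  exact (pow_eq_one_iff_of_nonneg (norm_nonneg _) two_ne_zero).1 h1

/-- **Rigidity.** A function whose short-time Fourier transform is pointwise dominated by that of
the Gaussian is a multiple of the Gaussian: the quotient of the two Bargmann transforms is a bounded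
entire function, hence constant. -/
theorem exists_eq_smul_gauss {f : L2} {C : ℝ}
    (h : ∀ z, ‖stft gauss f z‖ ≤ C * ‖stft gauss gauss z‖) : ∃ c : ℂ, f = c • gauss := by
  set F : ℂ → ℂ := fun ζ => bargmann f ζ * Complex.exp (-(Real.pi / 2 * ζ ^ 2)) with hF
  have hFd : Differentiable ℂ F := by
    refine (differentiable_bargmann f).mul ?_
    fun_prop
  have hFs : ∀ z : Phase, stft gauss f z = F (z.1 - z.2 * Complex.I) * stft gauss gauss z := by
    intro z
    rw [stft_gauss_eq_bargmann, stft_gauss_eq_bargmann, bargmann_gauss, hF]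
    simp only [Complex.exp_neg]
    field_simp
  have hb : Bornology.IsBounded (Set.range F) := by
    refine (Metric.isBounded_closedBall (x := (0 : ℂ)) (r := C)).subset ?_
    rintro _ ⟨ζ, rfl⟩
    have h1 := h (ζ.re, -ζ.im)
    have h2 : ((ζ.re : ℝ) : ℂ) - ((-ζ.im : ℝ) : ℂ) * Complex.I = ζ := by
      push_cast
      rw [neg_mul, sub_neg_eq_add, Complex.re_add_im]
    have h3 : 0 < ‖stft gauss gauss (ζ.re, -ζ.im)‖ := by
      rw [norm_stft_gauss_gauss]
      positivity
    rw [hFs, norm_mul, h2] at h1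
    rw [mem_closedBall_zero_iff]
    exact le_of_mul_le_mul_right h1 h3
  refine ⟨F 0, ?_⟩
  have hz : ∀ z, stft gauss (f - F 0 • gauss) z = 0 := fun z => by
    rw [stft, inner_sub_right, inner_smul_right]
    change stft gauss f z - F 0 * stft gauss gauss z = 0
    rw [hFs, hFd.apply_eq_apply_of_bounded hb _ 0, sub_self]
  have h4 := integral_norm_stft_sq gauss (f - F 0 • gauss)
  simp only [hz, norm_gauss] at h4
  rw [← sub_eq_zero, ← norm_eq_zero]
  simpa using h4.symm

/-- The phase-space condition forces the windows to be multiples of the Gaussian, uniformly close to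
it. -/
theorem PhaseSpaceClose.exists_eq_smul_gauss {I : Type*} {φ : I → L2} (h : PhaseSpaceClose φ) :
    ∃ C₀ < (1 : ℝ), ∀ i, ∃ c : ℂ, φ i = c • gauss ∧ ‖1 - c‖ < C₀ := by
  obtain ⟨-, C₀, h1, h2⟩ := h
  rw [integral_norm_stft_gauss_gauss] at h2
  refine ⟨C₀, by linarith, fun i => ?_⟩
  obtain ⟨c, hc⟩ := _root_.exists_eq_smul_gauss (f := φ i) (C := C₀ + 1) fun z => by
    have := norm_sub_norm_le (stft gauss (φ i) z) (stft gauss gauss z)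
    rw [norm_sub_rev] at this
    linarith [h1 i z]
  refine ⟨c, hc, ?_⟩
  have h3 := h1 i 0
  have h4 : 0 < ‖stft gauss gauss 0‖ := by
    rw [norm_stft_gauss_gauss]
    positivity
  rw [hc, stft_smul_right, ← one_sub_mul, norm_mul] at h3
  exact lt_of_mul_lt_mul_right h3 h4.le

/-! ### Frames of eigenfunctions -/

theorem locOp_smul_window (m : Phase → ℝ) (c : ℂ) (φ f : L2) :
    locOp m (c • φ) f = ((‖c‖ ^ 2 : ℝ) : ℂ) • locOp m φ f := by
  rw [locOp, locOp, ← integral_smul]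
  congr 1
  funext z
  rw [stft_smul_left, tfShift_smul, smul_smul, smul_smul]
  congr 1
  have h : starRingEnd ℂ c * c = ((‖c‖ ^ 2 : ℝ) : ℂ) := by simpa using RCLike.conj_mul c
  linear_combination (m z : ℂ) * stft φ f z * h

/-- Under either condition on the windows, the quadratic forms `⟨f, H_γ f⟩` of the localization
operators sum to at most `K ‖f‖²`, and the norms `‖H_γ f‖²` to at least `c ‖f‖²`, whichever window
is selected at each `γ`; the constants do not depend on the selection. -/
theorem exists_bounds_locOp {I : Type*} {φ : I → L2} (hφ : NormClose φ ∨ PhaseSpaceClose φ)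
    {Γ : Set Phase} {η : Γ → Phase → ℝ} (hη : WellSpread Γ η)
    (h0 : ∀ (γ : Γ) (z : Phase), 0 ≤ η γ z) (hsum : SumApproxOne η) :
    ∃ c K : ℝ, 0 < c ∧ 0 < K ∧ ∀ (k : Γ → I) (f : L2),
      (Summable fun γ => ∫ z, η γ z * ‖stft (φ (k γ)) f z‖ ^ 2) ∧
      ∑' γ, ∫ z, η γ z * ‖stft (φ (k γ)) f z‖ ^ 2 ≤ K * ‖f‖ ^ 2 ∧
      (Summable fun γ => ‖locOp (η γ) (φ (k γ)) f‖ ^ 2) ∧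
      c * ‖f‖ ^ 2 ≤ ∑' γ, ‖locOp (η γ) (φ (k γ)) f‖ ^ 2 := by
  classical
  rcases hφ with ⟨a, b, hab, hI, ha, -, hd⟩ | hφ
  · have huniv : (Set.univ : Set I) = ({a, b} : Finset I) := by
      ext i
      simpa using hI i
    have : Finite I := Set.finite_univ_iff.1 (huniv ▸ Finset.finite_toSet _)
    have := Fintype.ofFinite I
    -- the sum of the squared distances to `φ a` is less than `1/4`
    refine exists_le_tsum_norm_locOp_sq hη h0 hsum φ ha ?_
    have hu : (Finset.univ : Finset I) = {a, b} := by
      rw [← Finset.coe_inj, Finset.coe_univ, huniv]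
    rw [hu, Finset.sum_pair hab, sub_self, norm_zero, norm_sub_rev]
    nlinarith [norm_nonneg (φ a - φ b)]
  · obtain ⟨C₀, hC₀, h⟩ := hφ.exists_eq_smul_gauss
    choose s hs hs1 using h
    obtain ⟨c, K, hc, hK, H⟩ := exists_le_tsum_norm_locOp_sq hη h0 hsum (J := Unit)
      (fun _ => gauss) norm_gauss (by simp)
    have hup : ∀ i, ‖s i‖ ≤ 2 := fun i => by
      have := norm_sub_norm_le (s i) 1
      rw [norm_sub_rev, norm_one] at this
      linarith [hs1 i]
    have hlow : ∀ i, 1 - C₀ ≤ ‖s i‖ := fun i => by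
      have := norm_sub_norm_le 1 (s i)
      rw [norm_one] at this
      linarith [hs1 i]
    have hC : 0 < 1 - C₀ := by linarith
    refine ⟨(1 - C₀) ^ 4 * c, 2 ^ 2 * K, by positivity, by positivity, fun k f => ?_⟩
    obtain ⟨s1, u1, s2, u2⟩ := H (fun _ => ()) f
    have e1 : ∀ γ : Γ, ∫ z, η γ z * ‖stft (φ (k γ)) f z‖ ^ 2
        = ‖s (k γ)‖ ^ 2 * ∫ z, η γ z * ‖stft gauss f z‖ ^ 2 := fun γ => by
      rw [← integral_const_mul]
      congr 1
      funext z
      rw [hs, stft_smul_left, norm_mul, RCLike.norm_conj]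
      ring
    have e2 : ∀ γ : Γ, ‖locOp (η γ) (φ (k γ)) f‖ ^ 2
        = ‖s (k γ)‖ ^ 4 * ‖locOp (η γ) gauss f‖ ^ 2 := fun γ => by
      rw [hs, locOp_smul_window, norm_smul, Complex.norm_real, Real.norm_of_nonneg (by positivity)]
      ring
    have n1 : ∀ γ : Γ, 0 ≤ ∫ z, η γ z * ‖stft gauss f z‖ ^ 2 := fun γ =>
      integral_nonneg fun z => mul_nonneg (h0 γ z) (by positivity)
    have b1 : ∀ γ : Γ, ‖s (k γ)‖ ^ 2 * ∫ z, η γ z * ‖stft gauss f z‖ ^ 2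
        ≤ 2 ^ 2 * ∫ z, η γ z * ‖stft gauss f z‖ ^ 2 := fun γ =>
      mul_le_mul_of_nonneg_right (pow_le_pow_left₀ (norm_nonneg _) (hup _) 2) (n1 γ)
    have b2 : ∀ γ : Γ, ‖s (k γ)‖ ^ 4 * ‖locOp (η γ) gauss f‖ ^ 2
        ≤ 2 ^ 4 * ‖locOp (η γ) gauss f‖ ^ 2 := fun γ =>
      mul_le_mul_of_nonneg_right (pow_le_pow_left₀ (norm_nonneg _) (hup _) 4) (by positivity)
    have b3 : ∀ γ : Γ, (1 - C₀) ^ 4 * ‖locOp (η γ) gauss f‖ ^ 2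
        ≤ ‖s (k γ)‖ ^ 4 * ‖locOp (η γ) gauss f‖ ^ 2 := fun γ =>
      mul_le_mul_of_nonneg_right (pow_le_pow_left₀ hC.le (hlow _) 4) (by positivity)
    simp only [e1, e2]
    have s1' := Summable.of_nonneg_of_le (fun γ => mul_nonneg (by positivity) (n1 γ)) b1
      (s1.mul_left _)
    have s2' := Summable.of_nonneg_of_le (fun γ => by positivity) b2 (s2.mul_left _)
    refine ⟨s1', ?_, s2', ?_⟩
    · refine (s1'.tsum_le_tsum b1 (s1.mul_left _)).trans ?_
      rw [tsum_mul_left, mul_assoc]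
      gcongr
    · refine le_trans ?_ ((s2.mul_left _).tsum_le_tsum b3 s2')
      rw [tsum_mul_left, mul_assoc]
      gcongr

/-- The spectral step: if the eigenvalue threshold is small compared with the constants of
`exists_bounds_locOp`, every selection of eigenfunctions is a frame. -/
theorem isFrame_eigen_of_bounds {I : Type*} {φ : I → L2} {Γ : Set Phase} {η : Γ → Phase → ℝ}
    (hint : ∀ γ, Integrable (η γ)) (h0 : ∀ (γ : Γ) (z : Phase), 0 ≤ η γ z) {c K : ℝ} (hc : 0 < c)
    (hK : 0 < K) (k : Γ → I)
    (H : ∀ f : L2,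
      (Summable fun γ => ∫ z, η γ z * ‖stft (φ (k γ)) f z‖ ^ 2) ∧
      ∑' γ, ∫ z, η γ z * ‖stft (φ (k γ)) f z‖ ^ 2 ≤ K * ‖f‖ ^ 2 ∧
      (Summable fun γ => ‖locOp (η γ) (φ (k γ)) f‖ ^ 2) ∧
      c * ‖f‖ ^ 2 ≤ ∑' γ, ‖locOp (η γ) (φ (k γ)) f‖ ^ 2)
    {E : Γ → Set L2}
    (hE : ∀ γ, IsEigenCollection (locOp (η γ) (φ (k γ))) (c / (2 * K)) (E γ)) :
    IsFrame (fun p : (Σ γ : Γ, E γ) => (p.2 : L2)) := by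
  have hpos : ∀ γ (f : L2), 0 ≤ ∫ z, η γ z * ‖stft (φ (k γ)) f z‖ ^ 2 := fun γ f =>
    integral_nonneg fun z => mul_nonneg (h0 γ z) (by positivity)
  have hε : 0 < c / (2 * K) := by positivity
  have hb : ∀ γ f, (Summable fun e : E γ => ‖inner ℂ (e : L2) f‖ ^ 2) ∧
      c / (2 * K) * ∑' e : E γ, ‖inner ℂ (e : L2) f‖ ^ 2
        ≤ ∫ z, η γ z * ‖stft (φ (k γ)) f z‖ ^ 2 ∧
      ‖locOp (η γ) (φ (k γ)) f‖ ^ 2 ≤ K ^ 2 * ∑' e : E γ, ‖inner ℂ (e : L2) f‖ ^ 2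
        + c / (2 * K) * ∫ z, η γ z * ‖stft (φ (k γ)) f z‖ ^ 2 := fun γ f => by
    have hcoe : (⇑(locOpL (η γ) (φ (k γ))) : L2 → L2) = locOp (η γ) (φ (k γ)) :=
      funext fun f => locOpL_apply (hint γ) _ f
    have := IsEigenCollection.bounds (isCompactOperator_locOpL (hint γ) (φ (k γ)))
      (isSymmetric_locOpL (hint γ) (φ (k γ)))
      (fun x => by rw [re_inner_locOpL (hint γ)]; exact hpos γ x) hK
      (fun x => by
        rw [re_inner_locOpL (hint γ)]
        exact ((H x).1.le_tsum γ fun γ' _ => hpos γ' x).trans (H x).2.1)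
      hε (E := E γ) (by rw [hcoe]; exact hE γ) f
    rwa [re_inner_locOpL (hint γ), locOpL_apply (hint γ)] at this
  have key : ∀ f : L2, (Summable fun p : (Σ γ : Γ, E γ) => ‖inner ℂ (p.2 : L2) f‖ ^ 2) ∧
      c / (2 * K ^ 2) * ‖f‖ ^ 2 ≤ ∑' p : (Σ γ : Γ, E γ), ‖inner ℂ (p.2 : L2) f‖ ^ 2 ∧
      ∑' p : (Σ γ : Γ, E γ), ‖inner ℂ (p.2 : L2) f‖ ^ 2 ≤ 2 * K ^ 2 / c * ‖f‖ ^ 2 := fun f => by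
    obtain ⟨sQ, uQ, sT, lT⟩ := H f
    have hle : ∀ γ, ∑' e : E γ, ‖inner ℂ (e : L2) f‖ ^ 2
        ≤ 2 * K / c * ∫ z, η γ z * ‖stft (φ (k γ)) f z‖ ^ 2 := fun γ => by
      refine le_of_mul_le_mul_left ((hb γ f).2.1.trans_eq ?_) hε
      field_simp
    have sS : Summable fun γ => ∑' e : E γ, ‖inner ℂ (e : L2) f‖ ^ 2 :=
      Summable.of_nonneg_of_le (fun γ => tsum_nonneg fun e => by positivity) hle (sQ.mul_left _)
    have sum : Summable fun p : (Σ γ : Γ, E γ) => ‖inner ℂ (p.2 : L2) f‖ ^ 2 :=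
      (summable_sigma_of_nonneg fun _ => by positivity).2 ⟨fun γ => (hb γ f).1, sS⟩
    rw [sum.tsum_sigma' fun γ => (hb γ f).1]
    refine ⟨sum, ?_, ?_⟩
    · have h1 := lT.trans (sT.tsum_le_tsum (fun γ => (hb γ f).2.2)
        ((sS.mul_left _).add (sQ.mul_left _)))
      rw [(sS.mul_left _).tsum_add (sQ.mul_left _), tsum_mul_left, tsum_mul_left] at h1
      have h2 : c / (2 * K) * ∑' γ, ∫ z, η γ z * ‖stft (φ (k γ)) f z‖ ^ 2
          ≤ c / 2 * ‖f‖ ^ 2 := by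
        refine (mul_le_mul_of_nonneg_left uQ hε.le).trans_eq ?_
        field_simp
      have h3 : c / 2 * ‖f‖ ^ 2 ≤ K ^ 2 * ∑' γ, ∑' e : E γ, ‖inner ℂ (e : L2) f‖ ^ 2 := by
        linarith
      refine le_of_mul_le_mul_left (a := K ^ 2) (le_trans (le_of_eq ?_) h3) (by positivity)
      field_simp
    · refine (sS.tsum_le_tsum hle (sQ.mul_left _)).trans ?_
      rw [tsum_mul_left]
      refine (mul_le_mul_of_nonneg_left uQ (by positivity)).trans_eq ?_
      ring
  -- the maximum only serves to order the two bounds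
  refine ⟨c / (2 * K ^ 2), max (c / (2 * K ^ 2)) (2 * K ^ 2 / c), by positivity, le_max_left _ _,
    fun f => ⟨(key f).1, (key f).2.1, (key f).2.2.trans ?_⟩⟩
  gcongr
  exact le_max_right _ _

theorem IsFrame.of_equiv {ι κ : Type*} (e : κ ≃ ι) {x : ι → L2} (hx : IsFrame x) :
    IsFrame (x ∘ e) := by
  obtain ⟨A, B, hA, hAB, h⟩ := hx
  refine ⟨A, B, hA, hAB, fun f => ?_⟩
  obtain ⟨h1, h2, h3⟩ := h f
  have ht := e.tsum_eq fun j => ‖inner ℂ (x j) f‖ ^ 2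
  refine ⟨e.summable_iff.2 h1, ?_, ?_⟩
  · simpa only [Function.comp_apply, ht] using h2
  · simpa only [Function.comp_apply, ht] using h3

/-- Labels attached to the points of `α`, listed part by part for a partition `σ` of `α`, and listed
point by point. Here `k a` is the index of the part containing `a`. -/
def sigmaPartitionEquiv {I α : Type*} (σ : I → Set α) (k : α → I)
    (hk : ∀ i a, a ∈ σ i ↔ k a = i) (X : I → α → Type*) :
    (Σ i : I, Σ a : σ i, X i a) ≃ Σ a : α, X (k a) a where
  toFun p := ⟨p.2.1, cast (by rw [(hk _ _).1 p.2.1.2]) p.2.2⟩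
  invFun q := ⟨k q.1, ⟨q.1, (hk _ _).2 rfl⟩, q.2⟩
  left_inv := by
    rintro ⟨i, ⟨a, ha⟩, x⟩
    obtain rfl := (hk _ _).1 ha
    rfl
  right_inv := by
    rintro ⟨a, x⟩
    rfl

theorem mainTheorem1 {I : Type*} (φ : I → L2) (hφ : NormClose φ ∨ PhaseSpaceClose φ)
    (Γ : Set Phase) (η : Γ → Phase → ℝ) (hη : WellSpread Γ η)
    (hη_nonneg : ∀ (γ : Γ) (z : Phase), 0 ≤ η γ z) (hη_sum : SumApproxOne η) :
    ∃ ε : ℝ, 0 < ε ∧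
      ∀ E : I → Γ → Set L2,
        (∀ (i : I) (γ : Γ), IsEigenCollection (locOp (η γ) (φ i)) ε (E i γ)) →
          (∀ i : I, IsFrame (fun p : (Σ γ : Γ, E i γ) => (p.2 : L2))) ∧ IsWoven E := by
  obtain ⟨c, K, hc, hK, H⟩ := exists_bounds_locOp hφ hη hη_nonneg hη_sum
  refine ⟨c / (2 * K), by positivity, fun E hE => ?_⟩
  have hframe : ∀ k : Γ → I, IsFrame (fun p : (Σ γ : Γ, E (k γ) γ) => (p.2 : L2)) := fun k =>
    isFrame_eigen_of_bounds hη.integrable hη_nonneg hc hK k (H k) fun γ => hE (k γ) γ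
  refine ⟨fun i => hframe fun _ => i, fun σ hσ hcover => ?_⟩
  have hex : ∀ γ : Γ, ∃ i, γ ∈ σ i := fun γ => Set.mem_iUnion.1 (hcover ▸ Set.mem_univ γ)
  choose k hk using hex
  have hk' : ∀ i γ, γ ∈ σ i ↔ k γ = i := fun i γ => by
    refine ⟨fun h => ?_, fun h => h ▸ hk γ⟩
    by_contra hne
    exact Set.disjoint_left.1 (hσ hne) (hk γ) h
  have := (hframe k).of_equiv (sigmaPartitionEquiv σ k hk' fun i γ => E i γ)
  convert this using 1
  funext p
  obtain ⟨i, ⟨γ, hγ⟩, e⟩ := p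
  obtain rfl := (hk' _ _).1 hγ
  rfl

end
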